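/- Let $V(x)=x_1^2x_2-\frac13 x_2^3$ on $\mathbb R^2$; denote also by $V$ the maximal operator of multiplication by $V(x)$ in $L^2(\mathbb R^2)$, with domain $D(V)=\{u\in L^2(\mathbb R^2): Vu\in L^2(\mathbb R^2)\}$. Let $H_0$ be the harmonic oscillator, i.e. the closure in $L^2(\mathbb R^2)$ of $-\Delta+|x|^2$ on $C_0^\infty(\mathbb R^2)$. For $\beta,\theta\in\mathbb C$ let $$H(\beta,\theta)=-e^{-2\theta}\Delta+e^{2\theta}|x|^2+\beta e^{3\theta}V$$ be the operator sum in $L^2(\mathbb R^2)$, where $\Delta$ is the distributional Laplacian with domain $\{u\in L^2:\Delta u\in L^2\}$, $|x|^2$ is the maximal multiplication operator, and the domain of the sum is the intersection of the domains of the three summands. Let $$P=\{(s,t)\in\mathbb R^2:\ 0<t+s<\pi,\ 0<5t+s<\pi\}$$ and let $\Omega$ be the set of all $(\beta,\theta)\in\mathbb C^2$ such that $\beta\neq 0$ and $(s,\operatorname{Im}\theta)\in P$ for some determination $s$ of $\arg\beta$ (that is, some $s\in\mathbb R$ with $\beta=|\beta|e^{is}$). Then $H(\beta,\theta)$, $(\beta,\theta)\in\Omega$,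 is a holomorphic family of type A of closed operators with domain $D(H_0)\cap D(V)$: the set $\Omega$ is open and connected; for every $(\beta,\theta)\in\Omega$ the operator $H(\beta,\theta)$ is closed and its domain is $D(H_0)\cap D(V)$; and for every $u\in D(H_0)\cap D(V)$ the map $(\beta,\theta)\mapsto H(\beta,\theta)u$ is holomorphic from $\Omega$ to $L^2(\mathbb R^2)$. Moreover, for every $(\beta,\theta)\in\Omega$, $H(\beta,\theta)$ has compact resolvents: its resolvent set is non-empty, and $(z-H(\beta,\theta))^{-1}$ is compact for every $z$ in the resolvent set. -/

import Mathlib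

open MeasureTheory
open scoped ENNReal SchwartzMap ContDiff Laplacian

noncomputable section

namespace HenonHeiles

/-- The plane `ℝ²` with its Euclidean norm. -/
abbrev Plane : Type := EuclideanSpace ℝ (Fin 2)

/-- The Hilbert space `L²(ℝ²)` of complex-valued functions. -/
abbrev L2 : Type := Lp ℂ 2 (volume : Measure Plane)

/-- The maximal domain `{u ∈ L² | v u ∈ L²}` of multiplication by a real function `v`. -/
def mulDomain (v : Plane → ℝ) : Submodule ℂ L2 where
  carrier := {u | MemLp (fun x => (v x : ℂ) * u x) 2 volume}
  zero_mem' := by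
    refine (MemLp.zero (ε := ℂ)).ae_eq ?_
    filter_upwards [Lp.coeFn_zero ℂ 2 (volume : Measure Plane)] with x hx
    rw [hx, Pi.zero_apply, mul_zero]
  add_mem' := by
    intro a b ha hb
    refine (MemLp.add ha hb).ae_eq ?_
    filter_upwards [Lp.coeFn_add a b] with x hx
    rw [hx, Pi.add_apply, Pi.add_apply, mul_add]
  smul_mem' := by
    intro c a ha
    refine (MemLp.const_smul ha c).ae_eq ?_
    filter_upwards [Lp.coeFn_smul c a] with x hx
    rw [hx, Pi.smul_apply, Pi.smul_apply, smul_eq_mul, smul_eq_mul, mul_left_comm]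

theorem memLp_of_mem_mulDomain {v : Plane → ℝ} {u : L2} (hu : u ∈ mulDomain v) :
    MemLp (fun x => (v x : ℂ) * u x) 2 volume := hu

/-- The maximal operator `u ↦ v u` of multiplication by a real function `v` in `L²(ℝ²)`. -/
def mulOp (v : Plane → ℝ) : L2 →ₗ.[ℂ] L2 where
  domain := mulDomain v
  toFun :=
    { toFun := fun u => (memLp_of_mem_mulDomain u.2).toLp (fun x => (v x : ℂ) * (u : L2) x)
      map_add' := by
        intro a b
        apply Lp.ext
        filter_upwards [Lp.coeFn_add (a : L2) (b : L2),
          (memLp_of_mem_mulDomain (a + b).2).coeFn_toLp,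
          (memLp_of_mem_mulDomain a.2).coeFn_toLp, (memLp_of_mem_mulDomain b.2).coeFn_toLp,
          Lp.coeFn_add ((memLp_of_mem_mulDomain a.2).toLp _)
            ((memLp_of_mem_mulDomain b.2).toLp _)] with x h1 h2 h3 h4 h5
        rw [h2, h5, Pi.add_apply, h3, h4, Submodule.coe_add, h1, Pi.add_apply, mul_add]
      map_smul' := by
        intro c a
        apply Lp.ext
        filter_upwards [Lp.coeFn_smul c (a : L2),
          (memLp_of_mem_mulDomain (c • a).2).coeFn_toLp,
          (memLp_of_mem_mulDomain a.2).coeFn_toLp,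
          Lp.coeFn_smul c ((memLp_of_mem_mulDomain a.2).toLp _)] with x h1 h2 h3 h4
        rw [RingHom.id_apply, h2, h4, Pi.smul_apply, h3, Submodule.coe_smul, h1, Pi.smul_apply,
          smul_eq_mul, smul_eq_mul, mul_left_comm] }

/-- The pairs `(u, f)` of `L²` functions with `Δ u = f` in the sense of (tempered)
distributions. -/
def laplacianGraph : Submodule ℂ (L2 × L2) where
  carrier := {p | Δ (p.1 : 𝓢'(Plane, ℂ)) = (p.2 : 𝓢'(Plane, ℂ))}
  zero_mem' := by
    ext φ
    simp [← Lp.toTemperedDistributionCLM_apply]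
  add_mem' := by
    intro a b ha hb
    simp only [Set.mem_ofPred_eq, ← Lp.toTemperedDistributionCLM_apply,
      ← TemperedDistribution.laplacianCLM_apply, Prod.fst_add, Prod.snd_add, map_add] at *
    rw [ha, hb]
  smul_mem' := by
    intro c a ha
    simp only [Set.mem_ofPred_eq, ← Lp.toTemperedDistributionCLM_apply,
      ← TemperedDistribution.laplacianCLM_apply, Prod.smul_fst, Prod.smul_snd, map_smul] at *
    rw [ha]

/-- The Laplace operator in `L²(ℝ²)`, with domain `{u ∈ L² | Δ u ∈ L²}`. -/
def laplaceOp : L2 →ₗ.[ℂ] L2 := laplacianGraph.toLinearPMap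

/-- `laplacianGraph` is the graph of a function, so that `laplaceOp` has it as its graph. -/
theorem laplaceOp_graph : laplaceOp.graph = laplacianGraph := by
  refine Submodule.toLinearPMap_graph_eq _ ?_
  intro p hp h0
  have hp' : Δ (p.1 : 𝓢'(Plane, ℂ)) = (p.2 : 𝓢'(Plane, ℂ)) := hp
  rw [h0, ← Lp.toTemperedDistributionCLM_apply, ← TemperedDistribution.laplacianCLM_apply,
    map_zero, map_zero, ← Lp.toTemperedDistributionCLM_apply] at hp'
  have hk := Lp.ker_toTemperedDistributionCLM_eq_bot (F := ℂ) (μ := (volume : Measure Plane))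
    (p := 2)
  rw [LinearMap.ker_eq_bot'] at hk
  exact hk _ hp'.symm

/-- `C₀^∞(ℝ²)` as a subspace of `L²(ℝ²)`. -/
def testFunctions : Submodule ℂ L2 where
  carrier := {u | ∃ φ : Plane → ℂ, ContDiff ℝ ∞ φ ∧ HasCompactSupport φ ∧ u =ᵐ[volume] φ}
  zero_mem' := ⟨0, contDiff_const, HasCompactSupport.zero, Lp.coeFn_zero _ _ _⟩
  add_mem' := by
    rintro a b ⟨φ, hφ, hφ', ha⟩ ⟨ψ, hψ, hψ', hb⟩
    exact ⟨φ + ψ, hφ.add hψ, hφ'.add hψ', (Lp.coeFn_add a b).trans (ha.add hb)⟩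
  smul_mem' := by
    rintro c a ⟨φ, hφ, hφ', ha⟩
    exact ⟨c • φ, hφ.const_smul c, hφ'.smul_left (f := fun _ => c),
      (Lp.coeFn_smul c a).trans (ha.const_smul c)⟩

/-- The harmonic oscillator `H₀ = -Δ + x²`: the closure in `L²(ℝ²)` of the differential operator
on `C₀^∞(ℝ²)`. -/
def harmonicOscillator : L2 →ₗ.[ℂ] L2 :=
  ((-laplaceOp + mulOp (fun x => ‖x‖ ^ 2)).domRestrict testFunctions).closure

/-- The Hénon–Heiles potential `V(x) = x₁² x₂ - x₂³ / 3`. -/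
def potential (x : Plane) : ℝ := x 0 ^ 2 * x 1 - x 1 ^ 3 / 3

/-- The operator `H(β, θ) = -e^{-2θ} Δ + e^{2θ} x² + β e^{3θ} V` in `L²(ℝ²)`, as a sum of
unbounded operators (its domain is the intersection of the domains of the three summands). -/
def dilatedH (β θ : ℂ) : L2 →ₗ.[ℂ] L2 :=
  (-Complex.exp (-2 * θ)) • laplaceOp + Complex.exp (2 * θ) • mulOp (fun x => ‖x‖ ^ 2)
    + (β * Complex.exp (3 * θ)) • mulOp potential

/-- The parallelogram `P` of the `(s, t)`-plane. -/
def parallelogram : Set (ℝ × ℝ) :=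
  {p | 0 < p.2 + p.1 ∧ p.2 + p.1 < Real.pi ∧ 0 < 5 * p.2 + p.1 ∧ 5 * p.2 + p.1 < Real.pi}

/-- The pairs `(β, θ)`, `β ≠ 0`, such that `(s, Im θ) ∈ P` for some determination `s` of
`arg β`. In `P` the coordinate `s` ranges over `(-π/4, 5π/4)`, so the principal determination would
not do; as this interval is shorter than `2π`, the suitable `s` is unique. -/
def parameterRegion : Set (ℂ × ℂ) :=
  {p | p.1 ≠ 0 ∧ ∃ s : ℝ, p.1 = ‖p.1‖ * Complex.exp (s * Complex.I) ∧
    (s, p.2.im) ∈ parallelogram}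

/-- A holomorphic family of type (A) of closed operators with common domain `D`: the parameter
varies in a domain (open connected set) `Ω` of a complex normed space, every `T p` is closed with
domain `D`, and `p ↦ T p u` is holomorphic in `Ω` for every `u ∈ D`. -/
structure IsHolomorphicFamilyTypeA {P E F : Type*} [NormedAddCommGroup P] [NormedSpace ℂ P]
    [NormedAddCommGroup E] [NormedSpace ℂ E] [NormedAddCommGroup F] [NormedSpace ℂ F]
    (Ω : Set P) (T : P → E →ₗ.[ℂ] F) (D : Submodule ℂ E) : Prop where
  isOpen : IsOpen Ω
  isConnected : IsConnected Ω
  isClosed : ∀ p ∈ Ω, (T p).IsClosed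
  domain_eq : ∀ p ∈ Ω, (T p).domain = D
  holomorphic : ∀ u ∈ D, ∃ f : P → F, DifferentiableOn ℂ f Ω ∧ ∀ p ∈ Ω, (u, f p) ∈ (T p).graph

/-- The bounded operator `R` is the resolvent `(z - T)⁻¹` of `T` at `z`. -/
def IsResolventAt {E : Type*} [NormedAddCommGroup E] [NormedSpace ℂ E]
    (T : E →ₗ.[ℂ] E) (z : ℂ) (R : E →L[ℂ] E) : Prop :=
  (∀ f : E, ∃ h : R f ∈ T.domain, z • R f - T ⟨R f, h⟩ = f) ∧
    ∀ u : T.domain, R (z • (u : E) - T u) = u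

/-- `T` has compact resolvents: its resolvent set is non-empty, and its resolvent at every point
of the resolvent set is a compact operator. -/
def HasCompactResolvents {E : Type*} [NormedAddCommGroup E] [NormedSpace ℂ E]
    (T : E →ₗ.[ℂ] E) : Prop :=
  (∃ (z : ℂ) (R : E →L[ℂ] E), IsResolventAt T z R) ∧
    ∀ (z : ℂ) (R : E →L[ℂ] E), IsResolventAt T z R → IsCompactOperator R

end HenonHeiles

end

/-!
Put `b = β e^{5θ}`, so that `Im b > 0`, and write `e^{4θ} = τ² + κ b` with `τ > 0` and `κ` real.
Then `H(β, θ) = e^{-2θ} (S + b W)`, where `S = -Δ + τ² |x|²` is self-adjoint and `W = V + κ |x|²`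
is real, with `|∇W| ≤ C (1 + |x|²)`. On the core of Hermite functions, `Im ⟨(1 + S) p, W p⟩`
involves `W` only through its gradient. Hence the formal adjoint of
`(1 + l + S + b W) (1 + S)⁻¹` is bounded below for large `l`, and `1 + l + S + b W` is surjective;
its numerical range shows that it is injective with bounded inverse. The resolvents of `H(β, θ)` map
into the range of `(1 + S)⁻¹`, which is compact since `S` is triangular with respect to the degree
of the polynomial factor of a Hermite function.
-/

open scoped InnerProductSpace

noncomputable section

namespace HenonHeiles

section Triangular

variable {𝕜 H : Type*} [RCLike 𝕜] [NormedAddCommGroup H] [InnerProductSpace 𝕜 H]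
  {T : H →L[𝕜] H} {E : ℕ → Submodule 𝕜 H} {ν : ℕ → ℝ}

theorem map_mem_of_triangular (h_mono : Monotone E) (h_zero : E 0 = ⊥)
    (hT : ∀ N, ∀ x ∈ E (N + 1), T x - (ν N : 𝕜) • x ∈ E N) {N : ℕ} {x : H} (hx : x ∈ E N) :
    T x ∈ E N := by
  cases N with
  | zero => simp_all
  | succ N =>
    simpa using add_mem (h_mono N.le_succ (hT N x hx)) (Submodule.smul_mem _ (ν N : 𝕜) hx)

theorem apply_eq_smul_of_triangular (h_mono : Monotone E) (h_zero : E 0 = ⊥)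
    (h_symm : (T : H →ₗ[𝕜] H).IsSymmetric)
    (hT : ∀ N, ∀ x ∈ E (N + 1), T x - (ν N : 𝕜) • x ∈ E N) {N : ℕ} {z : H} (hz : z ∈ E (N + 1))
    (hz' : z ∈ (E N)ᗮ) : T z = (ν N : 𝕜) • z := by
  have h_orth : T z - (ν N : 𝕜) • z ∈ (E N)ᗮ := by
    refine sub_mem (fun x hx => ?_) (Submodule.smul_mem _ _ hz')
    exact (h_symm x z).symm.trans (hz' _ (map_mem_of_triangular h_mono h_zero hT hx))
  rw [← sub_eq_zero, ← inner_self_eq_zero (𝕜 := 𝕜)]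
  exact h_orth _ (hT N z hz)

theorem norm_apply_le_of_triangular [∀ N, FiniteDimensional 𝕜 (E N)] (h_mono : Monotone E)
    (h_zero : E 0 = ⊥) (h_symm : (T : H →ₗ[𝕜] H).IsSymmetric) (h_anti : Antitone ν)
    (h_nonneg : ∀ N, 0 ≤ ν N) (hT : ∀ N, ∀ x ∈ E (N + 1), T x - (ν N : 𝕜) • x ∈ E N)
    {N M : ℕ} (hNM : N ≤ M) {x : H} (hx : x ∈ E M) (hx' : x ∈ (E N)ᗮ) :
    ‖T x‖ ≤ ν N * ‖x‖ := by
  induction M, hNM using Nat.le_induction generalizing x with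
  | base => simp [inner_self_eq_zero.mp (hx' x hx)]
  | succ M hNM ih =>
    obtain ⟨y, hy, z, hz, rfl⟩ := (E M).exists_add_mem_mem_orthogonal x
    have hyM : y ∈ E (M + 1) := h_mono M.le_succ hy
    have hTz : T z = (ν M : 𝕜) • z :=
      apply_eq_smul_of_triangular h_mono h_zero h_symm hT (by simpa using sub_mem hx hyM) hz
    have hy' : y ∈ (E N)ᗮ := by
      simpa using sub_mem hx' (Submodule.orthogonal_le (h_mono hNM) hz)
    have h_sq : ‖y + z‖ * ‖y + z‖ = ‖y‖ * ‖y‖ + ‖z‖ * ‖z‖ :=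
      norm_add_sq_eq_norm_sq_add_norm_sq_of_inner_eq_zero _ _ (hz y hy)
    have hT_sq : ‖T (y + z)‖ * ‖T (y + z)‖ = ‖T y‖ * ‖T y‖ + (ν M * ‖z‖) * (ν M * ‖z‖) := by
      rw [map_add, norm_add_sq_eq_norm_sq_add_norm_sq_of_inner_eq_zero (𝕜 := 𝕜), hTz, norm_smul,
        RCLike.norm_of_nonneg (h_nonneg M)]
      rw [hTz]
      exact Submodule.smul_mem _ _ hz _ (map_mem_of_triangular h_mono h_zero hT hy)
    have hνN : 0 ≤ ν N := h_nonneg N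
    have hνM : 0 ≤ ν M := h_nonneg M
    refine nonneg_le_nonneg_of_sq_le_sq (by positivity) ?_
    calc ‖T (y + z)‖ * ‖T (y + z)‖
        = ‖T y‖ * ‖T y‖ + (ν M * ‖z‖) * (ν M * ‖z‖) := hT_sq
      _ ≤ (ν N * ‖y‖) * (ν N * ‖y‖) + (ν N * ‖z‖) * (ν N * ‖z‖) := by
        gcongr
        exacts [ih hy hy', ih hy hy', h_anti hNM, h_anti hNM]
      _ = (ν N * ‖y + z‖) * (ν N * ‖y + z‖) := by rw [mul_mul_mul_comm _ ‖y + z‖, h_sq]; ring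

theorem isCompactOperator_of_triangular [CompleteSpace H] [∀ N, FiniteDimensional 𝕜 (E N)]
    (h_mono : Monotone E) (h_zero : E 0 = ⊥) (h_dense : Dense (⋃ N, (E N : Set H)))
    (h_symm : (T : H →ₗ[𝕜] H).IsSymmetric) (h_anti : Antitone ν)
    (h_tendsto : Filter.Tendsto ν Filter.atTop (nhds 0))
    (hT : ∀ N, ∀ x ∈ E (N + 1), T x - (ν N : 𝕜) • x ∈ E N) : IsCompactOperator T := by
  have h_nonneg : ∀ N, 0 ≤ ν N := h_anti.le_of_tendsto h_tendsto
  have h_bound : ∀ N x, ‖T ((E N)ᗮ.starProjection x)‖ ≤ ν N * ‖x‖ := fun N x => by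
    refine h_dense.induction (fun x hx => ?_) (isClosed_le (by fun_prop) (by fun_prop)) x
    obtain ⟨M, hM⟩ := Set.mem_iUnion.mp hx
    have h_mem : (E N)ᗮ.starProjection x ∈ E (max N M) := by
      rw [Submodule.starProjection_orthogonal_val]
      exact sub_mem (h_mono (le_max_right _ _) hM)
        (h_mono (le_max_left _ _) (Submodule.starProjection_apply_mem _ _))
    refine (norm_apply_le_of_triangular h_mono h_zero h_symm h_anti h_nonneg hT (le_max_left N M)
      h_mem (Submodule.starProjection_apply_mem _ _)).trans ?_
    gcongr
    exacts [h_nonneg N, Submodule.norm_starProjection_apply_le _ _]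
  have h_lim : Filter.Tendsto (fun N => T ∘L (E N).starProjection) Filter.atTop (nhds T) := by
    rw [tendsto_iff_norm_sub_tendsto_zero]
    refine squeeze_zero (fun _ => norm_nonneg _) (fun N => ?_) h_tendsto
    rw [norm_sub_rev]
    refine ContinuousLinearMap.opNorm_le_bound _ (h_nonneg N) fun x => ?_
    simpa [Submodule.starProjection_orthogonal_val] using h_bound N x
  refine isCompactOperator_of_tendsto h_lim (.of_forall fun N => ?_)
  have h_proj : IsCompactOperator (E N).orthogonalProjectionOnto :=
    have := FiniteDimensional.proper 𝕜 (E N)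
    isCompactOperator_of_locallyCompactSpace_dom (E N).orthogonalProjectionOnto
  exact (h_proj.clm_comp (E N).subtypeL).clm_comp T

end Triangular

section Core

variable {P H : Type*} [AddCommGroup P] [Module ℂ P] [NormedAddCommGroup H] [InnerProductSpace ℂ H]
  {e : P →ₗ[ℂ] H} {A : Module.End ℂ P}

/-- The endomorphism `A` of `P`, transported by `e` to the dense subspace `e(P)` of a Hilbert space,
is a symmetric operator `≥ 1` mapping onto `e(P)`. Its closure is then self-adjoint, so that `e(P)`
is a core; the structure records the properties of that operator which are visible on the core. -/
structure IsSelfAdjointCore (e : P →ₗ[ℂ] H) (A : Module.End ℂ P) : Prop where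
  denseRange : DenseRange e
  surjective : Function.Surjective A
  inner_symm (p q : P) : ⟪e (A p), e q⟫_ℂ = ⟪e p, e (A q)⟫_ℂ
  norm_sq_le_inner (p : P) : ‖e p‖ ^ 2 ≤ (⟪e p, e (A p)⟫_ℂ).re

namespace IsSelfAdjointCore

theorem denseRange_comp (h : IsSelfAdjointCore e A) : DenseRange (e ∘ₗ A) := by
  rw [DenseRange, LinearMap.coe_comp, h.surjective.range_comp]
  exact h.denseRange

theorem norm_le (h : IsSelfAdjointCore e A) (p : P) : ‖e p‖ ≤ ‖e (A p)‖ := by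
  rcases (norm_nonneg (e p)).eq_or_lt with h0 | h0
  · rw [← h0]; exact norm_nonneg _
  · refine le_of_mul_le_mul_left ?_ h0
    rw [← sq]
    exact (h.norm_sq_le_inner p).trans (re_inner_le_norm (𝕜 := ℂ) _ _)

theorem im_inner (h : IsSelfAdjointCore e A) (p : P) : (⟪e p, e (A p)⟫_ℂ).im = 0 := by
  rw [← Complex.conj_eq_iff_im, inner_conj_symm, h.inner_symm]

end IsSelfAdjointCore

variable [CompleteSpace H]

/-- The operator `B A⁻¹` on the Hilbert space, for an endomorphism `B` of the core that is bounded
relative to `A` (and a junk value if it is not). -/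
def relOp (e : P →ₗ[ℂ] H) (A B : Module.End ℂ P) : H →L[ℂ] H :=
  (e ∘ₗ B).extendOfNorm (e ∘ₗ A)

namespace IsSelfAdjointCore

theorem relOp_apply (h : IsSelfAdjointCore e A) {B : Module.End ℂ P} {C : ℝ}
    (hB : ∀ p, ‖e (B p)‖ ≤ C * ‖e (A p)‖) (p : P) : relOp e A B (e (A p)) = e (B p) :=
  LinearMap.extendOfNorm_eq (f := e ∘ₗ B) h.denseRange_comp ⟨C, hB⟩ p

theorem relOp_one_apply (h : IsSelfAdjointCore e A) (p : P) : relOp e A 1 (e (A p)) = e p :=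
  h.relOp_apply (C := 1) (fun p => by simpa using h.norm_le p) p

theorem inner_relOp_one (h : IsSelfAdjointCore e A) (p : P) (y : H) :
    ⟪e (A p), relOp e A 1 y⟫_ℂ = ⟪e p, y⟫_ℂ := by
  refine h.denseRange_comp.induction_on
    (p := fun y => ⟪e (A p), relOp e A 1 y⟫_ℂ = ⟪e p, y⟫_ℂ) y
    (isClosed_eq (by fun_prop) (by fun_prop)) fun q => ?_
  rw [LinearMap.comp_apply, h.relOp_one_apply, h.inner_symm]

theorem isSymmetric_relOp_one (h : IsSelfAdjointCore e A) :
    (relOp e A 1 : H →ₗ[ℂ] H).IsSymmetric := fun z y => by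
  refine h.denseRange_comp.induction_on
    (p := fun z => ⟪relOp e A 1 z, y⟫_ℂ = ⟪z, relOp e A 1 y⟫_ℂ) z
    (isClosed_eq (by fun_prop) (by fun_prop)) fun p => ?_
  rw [LinearMap.comp_apply, h.relOp_one_apply, h.inner_relOp_one]

theorem norm_sq_relOp_one_le (h : IsSelfAdjointCore e A) (y : H) :
    ‖relOp e A 1 y‖ ^ 2 ≤ (⟪relOp e A 1 y, y⟫_ℂ).re := by
  refine h.denseRange_comp.induction_on
    (p := fun y => ‖relOp e A 1 y‖ ^ 2 ≤ (⟪relOp e A 1 y, y⟫_ℂ).re) y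
    (isClosed_le (by fun_prop) (Complex.continuous_re.comp (by fun_prop))) fun p => ?_
  rw [LinearMap.comp_apply, h.relOp_one_apply]
  exact h.norm_sq_le_inner p

/-- This is the essential self-adjointness of `A` on the core. -/
theorem eq_relOp_one_of_inner_eq (h : IsSelfAdjointCore e A) {u y : H}
    (huy : ∀ p, ⟪e (A p), u⟫_ℂ = ⟪e p, y⟫_ℂ) : u = relOp e A 1 y :=
  h.denseRange_comp.eq_of_inner_right ℂ fun p => by
    rw [LinearMap.comp_apply, huy, h.inner_relOp_one]

theorem relOp_one_injective (h : IsSelfAdjointCore e A) : Function.Injective (relOp e A 1) := by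
  refine (injective_iff_map_eq_zero _).mpr fun y hy => ?_
  refine h.denseRange.eq_zero_of_inner_right ℂ fun p => ?_
  rw [← h.inner_relOp_one, hy, inner_zero_right]

end IsSelfAdjointCore
end Core

section Perturbation

variable {P H : Type*} [AddCommGroup P] [Module ℂ P] [NormedAddCommGroup H] [InnerProductSpace ℂ H]

theorem exists_inner_eq_of_norm_le [CompleteSpace H] {J e : P →ₗ[ℂ] H} {C : ℝ}
    (h : ∀ p, ‖e p‖ ≤ C * ‖J p‖) (f : H) : ∃ w, ∀ p, ⟪J p, w⟫_ℂ = ⟪e p, f⟫_ℂ := by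
  let M := (LinearMap.range J).topologicalClosure
  let J' : P →ₗ[ℂ] M := J.codRestrict M fun p => subset_closure ⟨p, rfl⟩
  have h_dense : DenseRange J' := fun x => by
    rw [closure_subtype, ← Set.range_comp]
    exact x.2
  have h_ext : ∀ p, e.extendOfNorm J' (J' p) = e p := LinearMap.extendOfNorm_eq h_dense ⟨C, h⟩
  refine ⟨((e.extendOfNorm J').adjoint f : M), fun p => ?_⟩
  calc ⟪J p, ((e.extendOfNorm J').adjoint f : M)⟫_ℂ
      = ⟪J' p, (e.extendOfNorm J').adjoint f⟫_ℂ := rfl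
    _ = ⟪e p, f⟫_ℂ := by rw [ContinuousLinearMap.adjoint_inner_right, h_ext]

theorem le_of_coercive_bound {η K D r N j : ℝ} (hη : 0 < η) (hN : 0 ≤ N) (hK : 0 ≤ K) (hj : 0 ≤ j)
    (h : η * (N ^ 2 + D ^ 2 / (2 * η ^ 2) * r ^ 2) ≤ K * j * N + D * r * N) :
    N ≤ 2 * K / η * j := by
  have h_young : D * r * N ≤ η / 2 * N ^ 2 + η * (D ^ 2 / (2 * η ^ 2) * r ^ 2) := by
    have h_sq : η / 2 * N ^ 2 + η * (D ^ 2 / (2 * η ^ 2) * r ^ 2) - D * r * N =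
        (η * N - D * r) ^ 2 / (2 * η) := by field_simp; ring
    have := div_nonneg (sq_nonneg (η * N - D * r)) (by positivity : 0 ≤ 2 * η)
    linarith
  have h_half : η / 2 * N * N ≤ K * j * N := by linarith
  rcases hN.eq_or_lt with rfl | hN
  · positivity
  · rw [div_mul_eq_mul_div, le_div_iff₀ hη]
    linarith [le_of_mul_le_mul_right h_half hN]

/-- Multiplying by `conj b` separates the unperturbed form `x` from the perturbation `b y`. -/
theorem im_conj_mul_add (b y : ℂ) (x : ℝ) :
    ((starRingEnd ℂ) b * (x + b * y)).im = -(b.im * x) + ‖b‖ ^ 2 * y.im := by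
  rw [← Complex.normSq_eq_norm_sq, Complex.normSq_apply]
  simp only [Complex.mul_im, Complex.conj_re, Complex.conj_im, Complex.add_im, Complex.add_re,
    Complex.ofReal_im, Complex.ofReal_re, Complex.mul_re]
  ring

/-- Here `y` and `g` stand for `A u` and `M u`, where `A ≥ 1` and `M` are symmetric operators. -/
theorem norm_le_of_im_inner_eq_zero {u y g : H} {b : ℂ} (hb : 0 < b.im) {l : ℝ} (hl : 0 ≤ l)
    (huy : ‖u‖ ^ 2 ≤ (⟪u, y⟫_ℂ).re) (huy' : (⟪u, y⟫_ℂ).im = 0) (hug : (⟪u, g⟫_ℂ).im = 0) :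
    ‖u‖ ≤ ‖b‖ / b.im * ‖y + (l : ℂ) • u + b • g‖ := by
  set f := y + (l : ℂ) • u + b • g
  have h_inner : ⟪u, f⟫_ℂ = (((⟪u, y⟫_ℂ).re + l * ‖u‖ ^ 2 : ℝ) : ℂ) + b * ⟪u, g⟫_ℂ := by
    rw [inner_add_right, inner_add_right, inner_smul_right, inner_smul_right,
      inner_self_eq_norm_sq_to_K, ← Complex.re_add_im ⟪u, y⟫_ℂ, huy']
    simp
  have h_im := im_conj_mul_add b ⟪u, g⟫_ℂ ((⟪u, y⟫_ℂ).re + l * ‖u‖ ^ 2)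
  rw [← h_inner, hug, mul_zero, add_zero] at h_im
  have h_cs : |((starRingEnd ℂ) b * ⟪u, f⟫_ℂ).im| ≤ ‖b‖ * ‖f‖ * ‖u‖ := by
    refine (Complex.abs_im_le_norm _).trans ?_
    rw [norm_mul, RCLike.norm_conj, mul_assoc, mul_comm ‖f‖]
    gcongr
    exact norm_inner_le_norm _ _
  rw [h_im, abs_neg] at h_cs
  have h_lower : b.im * ‖u‖ * ‖u‖ ≤ ‖b‖ * ‖f‖ * ‖u‖ := by
    refine le_trans ?_ ((le_abs_self _).trans h_cs)
    rw [mul_assoc, ← sq]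
    gcongr
    exact huy.trans (le_add_of_nonneg_right (by positivity))
  rcases (norm_nonneg u).eq_or_lt with hu | hu
  · rw [← hu]; positivity
  · rw [div_mul_eq_mul_div, le_div_iff₀ hb, mul_comm]
    exact le_of_mul_le_mul_right h_lower hu

variable [CompleteSpace H] {e : P →ₗ[ℂ] H} {A M : Module.End ℂ P}

/-- The operator `A + l + b̄ A⁻¹ M A` is the formal adjoint of `1 + l A⁻¹ + b M A⁻¹`, composed
with `A`. -/
theorem IsSelfAdjointCore.norm_le_of_commutator (h : IsSelfAdjointCore e A)
    (hM : ∀ p q, ⟪e (M p), e q⟫_ℂ = ⟪e p, e (M q)⟫_ℂ) {C : ℝ}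
    (hC : ∀ p, |(⟪e (A p), e (M p)⟫_ℂ).im| ≤ C * √(⟪e p, e (A p)⟫_ℂ).re * ‖e (A p)‖)
    {b : ℂ} (hb : 0 < b.im) (p : P) :
    ‖e (A p)‖ ≤ 2 * ‖b‖ / b.im * ‖e (A p) +
      (((‖b‖ ^ 2 * C) ^ 2 / (2 * b.im ^ 2) : ℝ) : ℂ) • e p +
      (starRingEnd ℂ) b • relOp e A 1 (e (M (A p)))‖ := by
  set l : ℝ := (‖b‖ ^ 2 * C) ^ 2 / (2 * b.im ^ 2)
  set q : ℝ := (⟪e p, e (A p)⟫_ℂ).re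
  set j : H := e (A p) + (l : ℂ) • e p + (starRingEnd ℂ) b • relOp e A 1 (e (M (A p)))
  have hq : ⟪e p, e (A p)⟫_ℂ = (q : ℂ) := Complex.ext rfl (h.im_inner p)
  have h_inner : ⟪j, e (A p)⟫_ℂ =
      ((‖e (A p)‖ ^ 2 + l * q : ℝ) : ℂ) + b * ⟪e (A p), e (M p)⟫_ℂ := by
    have h_pert : ⟪relOp e A 1 (e (M (A p))), e (A p)⟫_ℂ = ⟪e (A p), e (M p)⟫_ℂ := by
      rw [h.isSymmetric_relOp_one.apply_clm, h.relOp_one_apply, hM]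
    rw [inner_add_left, inner_add_left, inner_smul_left, inner_smul_left, h_pert, hq,
      inner_self_eq_norm_sq_to_K]
    simp
  have h_cs : |((starRingEnd ℂ) b * ⟪j, e (A p)⟫_ℂ).im| ≤ ‖b‖ * ‖j‖ * ‖e (A p)‖ := by
    refine (Complex.abs_im_le_norm _).trans ?_
    rw [norm_mul, RCLike.norm_conj, mul_assoc]
    gcongr
    exact norm_inner_le_norm _ _
  rw [h_inner, im_conj_mul_add] at h_cs
  have h_comm : ‖b‖ ^ 2 * (⟪e (A p), e (M p)⟫_ℂ).im ≤ ‖b‖ ^ 2 * C * √q * ‖e (A p)‖ := by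
    rw [mul_assoc (‖b‖ ^ 2), mul_assoc (‖b‖ ^ 2)]
    gcongr
    exact (le_abs_self _).trans (hC p)
  refine le_of_coercive_bound (D := ‖b‖ ^ 2 * C) (r := √q) hb (norm_nonneg _) (norm_nonneg _)
    (norm_nonneg _) ?_
  rw [Real.sq_sqrt ((sq_nonneg _).trans (h.norm_sq_le_inner p))]
  linarith [neg_abs_le (-(b.im * (‖e (A p)‖ ^ 2 + l * q)) +
    ‖b‖ ^ 2 * (⟪e (A p), e (M p)⟫_ℂ).im)]

theorem IsSelfAdjointCore.exists_weak_solution (h : IsSelfAdjointCore e A)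
    (hM : ∀ p q, ⟪e (M p), e q⟫_ℂ = ⟪e p, e (M q)⟫_ℂ) {C : ℝ}
    (hC : ∀ p, |(⟪e (A p), e (M p)⟫_ℂ).im| ≤ C * √(⟪e p, e (A p)⟫_ℂ).re * ‖e (A p)‖)
    {b : ℂ} (hb : 0 < b.im) : ∃ l : ℝ, 0 ≤ l ∧ ∀ f : H, ∃ y g : H,
      (∀ p, ⟪e (M p), relOp e A 1 y⟫_ℂ = ⟪e p, g⟫_ℂ) ∧
        y + (l : ℂ) • relOp e A 1 y + b • g = f := by
  have hb0 : b ≠ 0 := fun h0 => by simp [h0] at hb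
  refine ⟨(‖b‖ ^ 2 * C) ^ 2 / (2 * b.im ^ 2), by positivity, fun f => ?_⟩
  set l : ℝ := (‖b‖ ^ 2 * C) ^ 2 / (2 * b.im ^ 2)
  let J : P →ₗ[ℂ] H := e ∘ₗ A + (l : ℂ) • e +
    (starRingEnd ℂ) b • ((relOp e A 1).toLinearMap ∘ₗ e ∘ₗ M ∘ₗ A)
  obtain ⟨y, hy⟩ := exists_inner_eq_of_norm_le (J := J) (e := e ∘ₗ A)
    (h.norm_le_of_commutator hM hC hb) f
  refine ⟨y, b⁻¹ • (f - y - (l : ℂ) • relOp e A 1 y), fun p => ?_, ?_⟩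
  · obtain ⟨p, rfl⟩ := h.surjective p
    have h_adj : ⟪e (A p), y⟫_ℂ + l * ⟪e p, y⟫_ℂ + b * ⟪e (M (A p)), relOp e A 1 y⟫_ℂ =
        ⟪e (A p), f⟫_ℂ := by
      rw [← LinearMap.comp_apply, ← hy p, ← h.isSymmetric_relOp_one.apply_clm]
      simp [J, mul_comm b]
    rw [inner_smul_right, inner_sub_right, inner_sub_right, inner_smul_right,
      h.inner_relOp_one, ← h_adj]
    field_simp
    ring
  · rw [smul_inv_smul₀ hb0]
    abel

end Perturbation

section Flag

variable {P : Type*} [AddCommGroup P]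

theorem exists_map_eq_of_triangular {k : Type*} [Field k] [Module k P] {A : Module.End k P}
    {F : ℕ → Submodule k P} {μ : ℕ → k} (h_mono : Monotone F) (h_zero : F 0 = ⊥)
    (hμ : ∀ N, μ N ≠ 0) (hA : ∀ N, ∀ p ∈ F (N + 1), A p - μ N • p ∈ F N) {N : ℕ} {p : P}
    (hp : p ∈ F N) : ∃ q ∈ F N, A q = p := by
  induction N generalizing p with
  | zero => exact ⟨0, zero_mem _, by simp_all⟩
  | succ N ih =>
    obtain ⟨q, hq, hAq⟩ := ih (hA N p hp)
    refine ⟨(μ N)⁻¹ • (p - q), Submodule.smul_mem _ _ (sub_mem hp (h_mono N.le_succ hq)), ?_⟩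
    rw [map_smul, map_sub, hAq, sub_sub_cancel, inv_smul_smul₀ (hμ N)]

theorem IsSelfAdjointCore.isCompactOperator_relOp_one {H : Type*} [Module ℂ P]
    [NormedAddCommGroup H] [InnerProductSpace ℂ H] [CompleteSpace H] {e : P →ₗ[ℂ] H}
    {A : Module.End ℂ P} (h : IsSelfAdjointCore e A) {F : ℕ → Submodule ℂ P}
    [∀ N, FiniteDimensional ℂ (F N)] (h_mono : Monotone F) (h_zero : F 0 = ⊥)
    (h_exhaust : ∀ p, ∃ N, p ∈ F N) {μ : ℕ → ℝ} (hμ : ∀ N, 0 < μ N) (hμ_mono : Monotone μ)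
    (hμ_tendsto : Filter.Tendsto μ Filter.atTop Filter.atTop)
    (hA : ∀ N, ∀ p ∈ F (N + 1), A p - (μ N : ℂ) • p ∈ F N) :
    IsCompactOperator (relOp e A 1) := by
  have hμ_ne : ∀ N, (μ N : ℂ) ≠ 0 := fun N => Complex.ofReal_ne_zero.mpr (hμ N).ne'
  refine isCompactOperator_of_triangular (E := fun N => (F N).map e) (ν := fun N => (μ N)⁻¹)
    (fun _ _ hNM => Submodule.map_mono (h_mono hNM)) (by simp [h_zero]) ?_ h.isSymmetric_relOp_one
    (fun N M hNM => inv_anti₀ (hμ N) (hμ_mono hNM)) hμ_tendsto.inv_tendsto_atTop ?_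
  · refine h.denseRange.mono ?_
    rintro _ ⟨p, rfl⟩
    obtain ⟨N, hN⟩ := h_exhaust p
    exact Set.mem_iUnion.mpr ⟨N, p, hN, rfl⟩
  · rintro N _ ⟨p, hp, rfl⟩
    obtain ⟨q, hq, rfl⟩ := exists_map_eq_of_triangular h_mono h_zero hμ_ne hA hp
    refine ⟨-((μ N : ℂ)⁻¹ • (A q - (μ N : ℂ) • q)),
      neg_mem (Submodule.smul_mem _ _ (hA N q hq)), ?_⟩
    rw [h.relOp_one_apply, smul_sub, inv_smul_smul₀ (hμ_ne N), neg_sub, map_sub, map_smul]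
    simp

end Flag

section GraphAlgebra

variable {R E F : Type*} [Ring R] [AddCommGroup E] [Module R E] [AddCommGroup F] [Module R F]

theorem mem_graph_add_iff {A B : E →ₗ.[R] F} {u : E} {f : F} :
    (u, f) ∈ (A + B).graph ↔
      ∃ a b, (u, a) ∈ A.graph ∧ (u, b) ∈ B.graph ∧ a + b = f := by
  simp only [LinearPMap.mem_graph_iff]
  constructor
  · rintro ⟨⟨u, hu⟩, rfl, rfl⟩
    exact ⟨_, _, ⟨⟨u, hu.1⟩, rfl, rfl⟩, ⟨⟨u, hu.2⟩, rfl, rfl⟩, rfl⟩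
  · rintro ⟨_, _, ⟨⟨u, hA⟩, rfl, rfl⟩, ⟨⟨v, hB⟩, hvu, rfl⟩, rfl⟩
    obtain rfl : v = u := hvu
    exact ⟨⟨v, hA, hB⟩, rfl, rfl⟩

theorem mem_graph_smul_iff {M : Type*} [Monoid M] [DistribMulAction M F] [SMulCommClass R M F]
    {A : E →ₗ.[R] F} {c : M} {u : E} {f : F} :
    (u, f) ∈ (c • A).graph ↔ ∃ a, (u, a) ∈ A.graph ∧ c • a = f := by
  simp only [LinearPMap.mem_graph_iff]
  constructor
  · rintro ⟨v, rfl, rfl⟩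
    exact ⟨_, ⟨v, rfl, rfl⟩, rfl⟩
  · rintro ⟨_, ⟨v, rfl, rfl⟩, rfl⟩
    exact ⟨v, rfl, rfl⟩

end GraphAlgebra

section Resolvent

variable {E : Type*} [NormedAddCommGroup E] [NormedSpace ℂ E] {T : E →ₗ.[ℂ] E} {z : ℂ}

theorem exists_isResolventAt {C : ℝ}
    (h_surj : ∀ f, ∃ u g, (u, g) ∈ T.graph ∧ z • u - g = f)
    (h_bound : ∀ u g, (u, g) ∈ T.graph → ‖u‖ ≤ C * ‖z • u - g‖) : ∃ R, IsResolventAt T z R := by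
  let A : T.domain →ₗ[ℂ] E := z • T.domain.subtype - T.toFun
  have norm_le (u : T.domain) : ‖u‖ ≤ C * ‖A u‖ := h_bound u (T u) (T.mem_graph u)
  have injective : Function.Injective A := by
    rw [injective_iff_map_eq_zero]
    intro u hu
    simpa only [hu, norm_zero, mul_zero, norm_le_zero_iff] using norm_le u
  have surjective : Function.Surjective A := fun f => by
    obtain ⟨u, g, hug, hf⟩ := h_surj f
    rw [LinearPMap.mem_graph_iff] at hug
    obtain ⟨v, rfl, rfl⟩ := hug
    exact ⟨v, hf⟩
  let B := LinearEquiv.ofBijective A ⟨injective, surjective⟩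
  have apply_symm (f : E) : A (B.symm f) = f := B.apply_symm_apply f
  refine ⟨LinearMap.mkContinuous (T.domain.subtype ∘ₗ B.symm.toLinearMap) C fun f => ?_,
    fun f => ⟨(B.symm f).2, apply_symm f⟩, fun u => congrArg Subtype.val (B.symm_apply_apply u)⟩
  have h := norm_le (B.symm f)
  rwa [apply_symm] at h

theorem IsResolventAt.mem_graph_iff {R : E →L[ℂ] E} (hR : IsResolventAt T z R) {u g : E} :
    (u, g) ∈ T.graph ↔ R (z • u - g) = u := by
  rw [LinearPMap.mem_graph_iff]
  constructor
  · rintro ⟨v, rfl, rfl⟩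
    exact hR.2 v
  · intro h
    obtain ⟨h_mem, h_eq⟩ := hR.1 (z • u - g)
    nth_rw 1 [h] at h_eq
    exact ⟨⟨_, h_mem⟩, h, sub_right_injective h_eq⟩

theorem IsResolventAt.isClosed {R : E →L[ℂ] E} (hR : IsResolventAt T z R) : T.IsClosed := by
  have graph_eq : (T.graph : Set (E × E)) = {p | R (z • p.1 - p.2) = p.1} :=
    Set.ext fun _ => hR.mem_graph_iff
  rw [LinearPMap.IsClosed, graph_eq]
  exact isClosed_eq (by fun_prop) continuous_fst

end Resolvent

theorem isCompactOperator_of_range_subset {𝕜 E F G : Type*} [NontriviallyNormedField 𝕜]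
    [NormedAddCommGroup E] [NormedSpace 𝕜 E] [CompleteSpace E]
    [NormedAddCommGroup F] [NormedSpace 𝕜 F] [CompleteSpace F]
    [NormedAddCommGroup G] [NormedSpace 𝕜 G] {K : F →L[𝕜] G} {R : E →L[𝕜] G}
    (hK : IsCompactOperator K) (hK_inj : Function.Injective K) (h : Set.range R ⊆ Set.range K) :
    IsCompactOperator R := by
  choose q hq using fun f => h ⟨f, rfl⟩
  let Q : E →ₗ[𝕜] F :=
    { toFun := q
      map_add' := fun f g => hK_inj (by simp only [hq, map_add])
      map_smul' := fun c f => hK_inj (by simp only [hq, map_smul, RingHom.id_apply]) }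
  have Q_continuous : Continuous Q := by
    refine Q.continuous_of_seq_closed_graph fun u x y hu hy => hK_inj ?_
    have tendsto_R : Filter.Tendsto (fun n => K (Q (u n))) Filter.atTop (nhds (R x)) :=
      ((R.continuous.tendsto x).comp hu).congr fun n => (hq (u n)).symm
    exact (tendsto_nhds_unique ((K.continuous.tendsto y).comp hy) tendsto_R).trans (hq x).symm
  have factorization : (R : E → G) = K ∘ (⟨Q, Q_continuous⟩ : E →L[𝕜] F) :=
    funext fun f => (hq f).symm
  rw [factorization]
  exact hK.comp_clm _

section Gaussian

theorem exists_one_add_pow_mul_exp_neg_sq_le {c : ℝ} (hc : 0 < c) (N : ℕ) :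
    ∃ K : ℝ, ∀ r : ℝ, 0 ≤ r → (1 + r) ^ N * Real.exp (-c * r ^ 2) ≤ K := by
  refine ⟨N.factorial * Real.exp (1 + 1 / (4 * c)), fun r hr => ?_⟩
  have pow_le_exp : (1 + r) ^ N ≤ N.factorial * Real.exp (1 + r) := by
    have := Real.pow_div_factorial_le_exp (1 + r) (by positivity) N
    rwa [div_le_iff₀' (by positivity)] at this
  have exponent_le : 1 + r + -c * r ^ 2 ≤ 1 + 1 / (4 * c) := by
    have completed_square :
        (2 * c * r - 1) ^ 2 / (4 * c) = c * r ^ 2 - r + 1 / (4 * c) := by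
      field_simp
      ring
    have : 0 ≤ (2 * c * r - 1) ^ 2 / (4 * c) := by positivity
    linarith
  calc (1 + r) ^ N * Real.exp (-c * r ^ 2)
      ≤ N.factorial * Real.exp (1 + r) * Real.exp (-c * r ^ 2) := by gcongr
    _ = N.factorial * Real.exp (1 + r + -c * r ^ 2) := by rw [mul_assoc, ← Real.exp_add]
    _ ≤ N.factorial * Real.exp (1 + 1 / (4 * c)) := by gcongr

variable {E : Type*} [NormedAddCommGroup E]

/-- The Gaussian `exp (-τ |x|² / 2)`, the ground state of `-Δ + τ² |x|²`. -/
def gauss (τ : ℝ) (x : E) : ℝ := Real.exp (-(τ / 2) * ‖x‖ ^ 2)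

theorem gauss_pos (τ : ℝ) (x : E) : 0 < gauss τ x := Real.exp_pos _

variable [InnerProductSpace ℝ E]

theorem contDiff_gauss (τ : ℝ) {n : WithTop ℕ∞} : ContDiff ℝ n (gauss τ : E → ℝ) :=
  (contDiff_const.mul (contDiff_norm_sq ℝ)).exp

theorem hasFDerivAt_gauss (τ : ℝ) (x : E) :
    HasFDerivAt (gauss τ) ((-τ * gauss τ x) • innerSL ℝ x) x := by
  refine ((hasStrictFDerivAt_norm_sq x).hasFDerivAt.const_mul (-(τ / 2))).exp.congr_fderiv ?_
  ext v
  simp only [neg_mul, neg_smul, smul_neg, neg_apply, smul_apply, coe_innerSL_apply, nsmul_eq_mul,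
    Nat.cast_ofNat, smul_eq_mul, gauss, neg_inj]
  ring

theorem exists_norm_iteratedFDeriv_gauss_le (τ : ℝ) (n : ℕ) :
    ∃ (N : ℕ) (K : ℝ), 0 ≤ K ∧ ∀ x : E,
      ‖iteratedFDeriv ℝ n (gauss τ) x‖ ≤ K * ((1 + ‖x‖) ^ N * gauss τ x) := by
  have exponent_growth : (fun x : E => -(τ / 2) * ‖x‖ ^ 2).HasTemperateGrowth :=
    (Function.HasTemperateGrowth.const (-(τ / 2))).mul (Function.hasTemperateGrowth_norm_sq E)
  obtain ⟨k, K, hK, h_exponent⟩ := exponent_growth.norm_iteratedFDeriv_le_uniform n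
  refine ⟨k * n, n.factorial * (1 + K) ^ n, by positivity, fun x => ?_⟩
  have base_ge_one : 1 ≤ (1 + K) * (1 + ‖x‖) ^ k :=
    one_le_mul_of_one_le_of_one_le (by linarith)
      (one_le_pow₀ (le_add_of_nonneg_right (norm_nonneg x)))
  have exp_bound (i : ℕ) (_ : i ≤ n) :
      ‖iteratedFDeriv ℝ i Real.exp (-(τ / 2) * ‖x‖ ^ 2)‖ ≤ gauss τ x := by
    rw [norm_iteratedFDeriv_eq_norm_iteratedDeriv, iteratedDeriv_eq_iterate, Real.iter_deriv_exp,
      Real.norm_of_nonneg (Real.exp_pos _).le, gauss]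
  have exponent_bound (i : ℕ) (hi : 1 ≤ i) (hin : i ≤ n) :
      ‖iteratedFDeriv ℝ i (fun x : E => -(τ / 2) * ‖x‖ ^ 2) x‖ ≤
        ((1 + K) * (1 + ‖x‖) ^ k) ^ i :=
    calc ‖iteratedFDeriv ℝ i (fun x : E => -(τ / 2) * ‖x‖ ^ 2) x‖
        ≤ K * (1 + ‖x‖) ^ k := h_exponent i hin x
      _ ≤ (1 + K) * (1 + ‖x‖) ^ k := by gcongr; linarith
      _ ≤ ((1 + K) * (1 + ‖x‖) ^ k) ^ i := le_self_pow₀ base_ge_one (by omega)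
  calc ‖iteratedFDeriv ℝ n (gauss τ) x‖
      ≤ n.factorial * gauss τ x * ((1 + K) * (1 + ‖x‖) ^ k) ^ n :=
        norm_iteratedFDeriv_comp_le (N := n) Real.contDiff_exp
          (contDiff_const.mul (contDiff_norm_sq ℝ)) le_rfl x exp_bound exponent_bound
    _ = n.factorial * (1 + K) ^ n * ((1 + ‖x‖) ^ (k * n) * gauss τ x) := by
      rw [mul_pow, ← pow_mul]
      ring

/-- The Gaussian `gauss τ` as a complex-valued Schwartz function. -/
def gaussSchwartz {τ : ℝ} (hτ : 0 < τ) : 𝓢(E, ℂ) :=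
  SchwartzMap.postcompCLM Complex.ofRealCLM
    { toFun := gauss τ
      smooth' := contDiff_gauss τ
      decay' := fun k n => by
        obtain ⟨N, K, hK, h_deriv⟩ := exists_norm_iteratedFDeriv_gauss_le (E := E) τ n
        obtain ⟨K', h_exp⟩ := exists_one_add_pow_mul_exp_neg_sq_le (half_pos hτ) (k + N)
        refine ⟨K * K', fun x => ?_⟩
        calc ‖x‖ ^ k * ‖iteratedFDeriv ℝ n (gauss τ) x‖
            ≤ (1 + ‖x‖) ^ k * (K * ((1 + ‖x‖) ^ N * gauss τ x)) := by
              gcongr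
              · linarith
              · exact h_deriv x
          _ = K * ((1 + ‖x‖) ^ (k + N) * gauss τ x) := by ring
          _ ≤ K * K' := by
              gcongr
              exact h_exp _ (norm_nonneg x) }

end Gaussian

theorem hasSum_integral_pow_div_factorial_smul {α F : Type*} [MeasurableSpace α] {μ : Measure α}
    [NormedAddCommGroup F] [NormedSpace ℂ F] {c : α → ℂ} {g : α → F}
    (hc : AEStronglyMeasurable c μ) (hg : AEStronglyMeasurable g μ)
    (h_exp : Integrable (fun x => Real.exp ‖c x‖ * ‖g x‖) μ) :
    HasSum (fun n : ℕ => ∫ x, (c x ^ n / n.factorial) • g x ∂μ)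
      (∫ x, Complex.exp (c x) • g x ∂μ) := by
  have exp_series (y : ℝ) : HasSum (fun n : ℕ => y ^ n / n.factorial) (Real.exp y) := by
    rw [Real.exp_eq_exp_ℝ]
    exact NormedSpace.expSeries_div_hasSum_exp y
  have cexp_series (y : ℂ) : HasSum (fun n : ℕ => y ^ n / n.factorial) (Complex.exp y) := by
    rw [Complex.exp_eq_exp_ℂ]
    exact NormedSpace.expSeries_div_hasSum_exp y
  refine hasSum_integral_of_dominated_convergence
    (fun (n : ℕ) x => ‖c x‖ ^ n / n.factorial * ‖g x‖) (fun n => ?_)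
    (fun n => .of_forall fun x => ?_)
    (.of_forall fun x => ((exp_series _).mul_right _).summable) ?_
    (.of_forall fun x => (cexp_series (c x)).smul_const (g x))
  · simp only [div_eq_mul_inv]
    exact ((hc.pow n).mul_const _).smul hg
  · rw [norm_smul, norm_div, norm_pow, Complex.norm_natCast]
  · simpa only [((exp_series _).mul_right _).tsum_eq] using h_exp

section FourierUniqueness

open scoped FourierTransform

variable {E F : Type*} [NormedAddCommGroup E] [InnerProductSpace ℝ E] [FiniteDimensional ℝ E]
  [MeasurableSpace E] [BorelSpace E] [NormedAddCommGroup F] [NormedSpace ℂ F]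

theorem fourier_eq_zero_of_moments_eq_zero {g : E → F}
    (hg : ∀ r : ℝ, Integrable fun x => Real.exp (r * ‖x‖) • g x)
    (h : ∀ (ξ : E) (n : ℕ), ∫ x, (inner ℝ x ξ ^ n : ℝ) • g x = 0) : 𝓕 g = 0 := by
  ext ξ
  have g_meas : AEStronglyMeasurable g := by simpa using (hg 0).aestronglyMeasurable
  let c (x : E) : ℂ := ((-2 * Real.pi * inner ℝ x ξ : ℝ) : ℂ) * Complex.I
  have c_continuous : Continuous c := by fun_prop
  have norm_c_le (x : E) : ‖c x‖ ≤ 2 * Real.pi * ‖ξ‖ * ‖x‖ := by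
    calc ‖c x‖ = 2 * Real.pi * |inner ℝ x ξ| := by simp [c, abs_of_pos Real.pi_pos]
      _ ≤ 2 * Real.pi * (‖x‖ * ‖ξ‖) := by gcongr; exact abs_real_inner_le_norm x ξ
      _ = 2 * Real.pi * ‖ξ‖ * ‖x‖ := by ring
  have exp_integrable : Integrable fun x => Real.exp ‖c x‖ * ‖g x‖ := by
    refine (hg (2 * Real.pi * ‖ξ‖)).mono
      ((by fun_prop : Continuous fun x => Real.exp ‖c x‖).aestronglyMeasurable.mul g_meas.norm)
      (.of_forall fun x => ?_)
    rw [norm_mul, norm_norm, norm_smul, Real.norm_eq_abs, Real.abs_exp, Real.norm_eq_abs,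
      Real.abs_exp]
    gcongr
    exact norm_c_le x
  have integral_term (n : ℕ) : ∫ x, (c x ^ n / n.factorial) • g x = 0 := by
    have term_eq (x : E) : (c x ^ n / n.factorial) • g x =
        ((-2 * Real.pi * Complex.I) ^ n / n.factorial) • ((inner ℝ x ξ ^ n : ℝ) • g x) := by
      rw [← Complex.coe_smul, smul_smul]
      congr 1
      simp only [c]
      push_cast
      ring
    simp only [term_eq, integral_smul, h, smul_zero]
  have integral_series :=
    hasSum_integral_pow_div_factorial_smul c_continuous.aestronglyMeasurable g_meas exp_integrable
  simp only [integral_term] at integral_series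
  rw [Real.fourier_eq']
  exact integral_series.unique hasSum_zero

theorem ae_eq_zero_of_fourier_eq_zero [CompleteSpace F] {g : E → F} (hg : Integrable g)
    (h : 𝓕 g = 0) : g =ᵐ[volume] 0 := by
  refine ae_eq_zero_of_integral_contDiff_smul_eq_zero hg.locallyIntegrable
    fun ψ ψ_contDiff ψ_support => ?_
  have Ψ_support : HasCompactSupport (Complex.ofRealCLM ∘ ψ) := ψ_support.comp_left rfl
  let Ψ : 𝓢(E, ℂ) := Ψ_support.toSchwartzMap (by fun_prop)
  have plancherel := VectorFourier.integral_fourierIntegral_smul_eq_flip (L := innerₗ E)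
    (μ := volume) (ν := volume) Real.continuous_fourierChar continuous_inner
    (𝓕⁻ Ψ : 𝓢(E, ℂ)).integrable hg
  have fourier_Ψ (x : E) : VectorFourier.fourierIntegral Real.fourierChar volume (innerₗ E)
      (⇑(𝓕⁻ Ψ : 𝓢(E, ℂ))) x = (ψ x : ℂ) := by
    have inversion := DFunLike.congr_fun (FourierTransform.fourier_fourierInv_eq Ψ : 𝓕 (𝓕⁻ Ψ) = Ψ) x
    rw [SchwartzMap.fourier_coe] at inversion
    exact inversion
  have fourier_g (ξ : E) :
      VectorFourier.fourierIntegral Real.fourierChar volume (innerₗ E).flip g ξ = 0 := by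
    rw [flip_innerₗ]
    exact congrFun h ξ
  simpa only [fourier_Ψ, fourier_g, smul_zero, integral_zero, Complex.coe_smul] using plancherel

theorem ae_eq_zero_of_moments_eq_zero [CompleteSpace F] {g : E → F}
    (hg : ∀ r : ℝ, Integrable fun x => Real.exp (r * ‖x‖) • g x)
    (h : ∀ (ξ : E) (n : ℕ), ∫ x, (inner ℝ x ξ ^ n : ℝ) • g x = 0) : g =ᵐ[volume] 0 :=
  ae_eq_zero_of_fourier_eq_zero (by simpa using hg 0) (fourier_eq_zero_of_moments_eq_zero hg h)

end FourierUniqueness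

section Hermite

open scoped LineDeriv

open MvPolynomial (pderiv)

theorem inner_lineDeriv_toLp_left {E : Type*} [NormedAddCommGroup E] [NormedSpace ℝ E]
    [FiniteDimensional ℝ E] [MeasurableSpace E] [BorelSpace E] {μ : Measure E} [μ.IsAddHaarMeasure]
    (f g : 𝓢(E, ℂ)) (v : E) :
    ⟪(∂_{v} f).toLp 2 μ, g.toLp 2 μ⟫_ℂ = -⟪f.toLp 2 μ, (∂_{v} g).toLp 2 μ⟫_ℂ := by
  simp only [SchwartzMap.inner_toL2_toL2_eq, RCLike.inner_apply']
  rw [← neg_eq_iff_eq_neg]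
  exact (SchwartzMap.integral_bilinear_lineDerivOp_right_eq_neg_left f g
    (ContinuousLinearMap.mul ℝ ℂ ∘L (Complex.conjCLE : ℂ →L[ℝ] ℂ)) v).symm

theorem inner_toLp_eq_integral {E : Type*} [NormedAddCommGroup E] [NormedSpace ℝ E]
    [MeasurableSpace E] [BorelSpace E] {μ : Measure E} [μ.HasTemperateGrowth]
    (φ : 𝓢(E, ℂ)) (u : Lp ℂ 2 μ) :
    ⟪φ.toLp 2 μ, u⟫_ℂ = ∫ x, starRingEnd ℂ (φ x) * u x ∂μ := by
  rw [L2.inner_def]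
  refine integral_congr_ae ?_
  filter_upwards [φ.coeFn_toLp 2 μ] with x hx
  rw [hx, RCLike.inner_apply']

variable {ι : Type*}

/-- The function on Euclidean space defined by a polynomial with complex coefficients. -/
def polyEval : MvPolynomial ι ℂ →ₐ[ℂ] (EuclideanSpace ℝ ι → ℂ) :=
  MvPolynomial.aeval fun i x => (x i : ℂ)

@[simp]
theorem polyEval_X (i : ι) (x : EuclideanSpace ℝ ι) :
    polyEval (MvPolynomial.X i) x = x i := by
  rw [polyEval, MvPolynomial.aeval_X]

@[simp]
theorem polyEval_C (a : ℂ) (x : EuclideanSpace ℝ ι) : polyEval (MvPolynomial.C a) x = a := by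
  rw [polyEval, MvPolynomial.aeval_C, Pi.algebraMap_apply, Algebra.algebraMap_self_apply]

/-- The complex-valued coordinate function `x ↦ x_j`. -/
def coordCLM (j : ι) : EuclideanSpace ℝ ι →L[ℝ] ℂ :=
  Complex.ofRealCLM ∘L EuclideanSpace.proj j

theorem coordCLM_apply (j : ι) (x : EuclideanSpace ℝ ι) : coordCLM j x = (x j : ℂ) := rfl

theorem coe_polyEval_X (j : ι) : polyEval (MvPolynomial.X j) = coordCLM j :=
  funext (polyEval_X j)

/-- The operator `∂_j - τ x_j` on polynomials, which is `∂_j` conjugated by the Gaussian. -/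
def gaussDeriv (τ : ℝ) (j : ι) : Module.End ℂ (MvPolynomial ι ℂ) :=
  (pderiv j).toLinearMap - LinearMap.mulLeft ℂ (MvPolynomial.C (τ : ℂ) * MvPolynomial.X j)

theorem gaussDeriv_apply (τ : ℝ) (j : ι) (p : MvPolynomial ι ℂ) :
    gaussDeriv τ j p = pderiv j p - MvPolynomial.C (τ : ℂ) * MvPolynomial.X j * p := rfl

theorem gaussDeriv_mul (τ : ℝ) (j : ι) (w p : MvPolynomial ι ℂ) :
    gaussDeriv τ j (w * p) = pderiv j w * p + w * gaussDeriv τ j p := by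
  simp only [gaussDeriv_apply, Derivation.leibniz, smul_eq_mul]
  ring

variable [Fintype ι]

theorem hasTemperateGrowth_polyEval (p : MvPolynomial ι ℂ) : (polyEval p).HasTemperateGrowth := by
  induction p using MvPolynomial.induction_on with
  | C a =>
    rw [funext (polyEval_C a)]
    exact .const a
  | add p q hp hq =>
    rw [map_add]
    exact hp.add hq
  | mul_X p i hp =>
    rw [map_mul, coe_polyEval_X]
    exact hp.mul (coordCLM i).hasTemperateGrowth

theorem hasFDerivAt_polyEval (p : MvPolynomial ι ℂ) (x : EuclideanSpace ℝ ι) :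
    HasFDerivAt (polyEval p) (∑ j, polyEval (pderiv j p) x • coordCLM j) x := by
  classical
  induction p using MvPolynomial.induction_on with
  | C a =>
    rw [funext (polyEval_C a)]
    exact (hasFDerivAt_const a x).congr_fderiv (by ext v; simp)
  | add p q hp hq =>
    rw [map_add]
    refine (hp.add hq).congr_fderiv ?_
    ext v
    simp [add_mul, Finset.sum_add_distrib]
  | mul_X p i hp =>
    rw [map_mul, coe_polyEval_X]
    refine (hp.mul (coordCLM i).hasFDerivAt).congr_fderiv ?_
    ext v
    simp [coordCLM_apply, Derivation.leibniz, MvPolynomial.pderiv_X, Pi.single_apply,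
      apply_ite polyEval, ite_apply, add_mul, Finset.sum_add_distrib, Finset.mul_sum, mul_assoc]

variable {τ : ℝ}

/-- The Schwartz function `p(x) exp (-τ |x|² / 2)`; these are the finite linear combinations of
the Hermite functions of `-Δ + τ² |x|²`. -/
def polyGauss (hτ : 0 < τ) : MvPolynomial ι ℂ →ₗ[ℂ] 𝓢(EuclideanSpace ℝ ι, ℂ) where
  toFun p := SchwartzMap.smulLeftCLM ℂ (polyEval p) (gaussSchwartz hτ)
  map_add' p q := by
    rw [map_add, SchwartzMap.smulLeftCLM_add (hasTemperateGrowth_polyEval p)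
      (hasTemperateGrowth_polyEval q), add_apply]
  map_smul' c p := by
    rw [map_smul, SchwartzMap.smulLeftCLM_smul (hasTemperateGrowth_polyEval p)]
    rfl

theorem polyGauss_apply (hτ : 0 < τ) (p : MvPolynomial ι ℂ) (x : EuclideanSpace ℝ ι) :
    polyGauss hτ p x = polyEval p x * gauss τ x :=
  SchwartzMap.smulLeftCLM_apply_apply (hasTemperateGrowth_polyEval p) _ x

theorem lineDeriv_polyGauss (hτ : 0 < τ) (j : ι) (p : MvPolynomial ι ℂ) :
    ∂_{EuclideanSpace.basisFun ι ℝ j} (polyGauss hτ p) = polyGauss hτ (gaussDeriv τ j p) := by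
  classical
  ext x
  have h_deriv : HasFDerivAt (polyGauss hτ p) _ x :=
    ((hasFDerivAt_polyEval p x).mul
      (Complex.ofRealCLM.hasFDerivAt.comp x (hasFDerivAt_gauss τ x))).congr_of_eventuallyEq
        (.of_forall (polyGauss_apply hτ p))
  rw [SchwartzMap.lineDerivOp_apply_eq_fderiv, h_deriv.fderiv, polyGauss_apply, gaussDeriv_apply]
  simp only [neg_mul, neg_smul, ContinuousLinearMap.comp_neg, ContinuousLinearMap.comp_smulₛₗ,
    Real.ringHom_apply, smul_neg, Function.comp_apply, Complex.ofRealCLM_apply,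
    EuclideanSpace.basisFun_apply, add_apply, neg_apply, smul_apply,
    ContinuousLinearMap.comp_apply, coe_innerSL_apply, EuclideanSpace.inner_single_right, one_mul,
    Complex.real_smul, Complex.ofReal_mul, smul_eq_mul, sum_apply, coordCLM_apply,
    PiLp.single_apply, apply_ite Complex.ofReal, Complex.ofReal_one, Complex.ofReal_zero, mul_ite,
    mul_one, mul_zero, Finset.sum_ite_eq', Finset.mem_univ, ↓reduceIte, map_sub, map_mul,
    MvPolynomial.algHom_C, Pi.sub_apply, Pi.mul_apply, Pi.algebraMap_apply,
    Algebra.algebraMap_self, RingHom.id_apply, polyEval_X]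
  ring

theorem laplacian_polyGauss (hτ : 0 < τ) (p : MvPolynomial ι ℂ) :
    Δ (polyGauss hτ p) = polyGauss hτ (∑ j, gaussDeriv τ j (gaussDeriv τ j p)) := by
  rw [SchwartzMap.laplacian_eq_sum (EuclideanSpace.basisFun ι ℝ)]
  simp only [lineDeriv_polyGauss, map_sum]

/-- The Hilbert space `L²(ℝⁿ)` of complex-valued functions; `EuclideanL2 (Fin 2)` is `L2`. -/
abbrev EuclideanL2 (ι : Type*) [Fintype ι] : Type _ :=
  Lp ℂ 2 (volume : Measure (EuclideanSpace ℝ ι))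

/-- The embedding `p ↦ p(x) exp (-τ |x|² / 2)` of polynomials into `L²`. -/
def hermite (hτ : 0 < τ) : MvPolynomial ι ℂ →ₗ[ℂ] EuclideanL2 ι :=
  (SchwartzMap.toLpCLM ℂ ℂ 2 volume).toLinearMap ∘ₗ polyGauss hτ

theorem hermite_apply (hτ : 0 < τ) (p : MvPolynomial ι ℂ) :
    hermite hτ p = (polyGauss hτ p).toLp 2 := rfl

theorem coeFn_hermite (hτ : 0 < τ) (p : MvPolynomial ι ℂ) :
    hermite hτ p =ᵐ[volume] polyGauss hτ p := SchwartzMap.coeFn_toLp _ 2 _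

theorem inner_hermite (hτ : 0 < τ) (p : MvPolynomial ι ℂ) (u : EuclideanL2 ι) :
    ⟪hermite hτ p, u⟫_ℂ = ∫ x, starRingEnd ℂ (polyGauss hτ p x) * u x :=
  inner_toLp_eq_integral (polyGauss hτ p) u

theorem memLp_exp_mul_polyGauss (hτ : 0 < τ) (r : ℝ) (p : MvPolynomial ι ℂ) :
    MemLp (fun x => (Real.exp (r * ‖x‖) : ℂ) * polyGauss hτ p x) 2 volume := by
  have h := (polyGauss (half_pos hτ) p).memLp 2
  refine (h.const_mul (Real.exp (r ^ 2 / τ) : ℂ)).of_le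
    (Continuous.aestronglyMeasurable (by fun_prop)) (.of_forall fun x => ?_)
  have exponent_le : r * ‖x‖ - τ / 2 * ‖x‖ ^ 2 ≤ r ^ 2 / τ - τ / 2 / 2 * ‖x‖ ^ 2 := by
    have completed_square :
        (τ * ‖x‖ - 2 * r) ^ 2 / (4 * τ) = τ * ‖x‖ ^ 2 / 4 - r * ‖x‖ + r ^ 2 / τ := by
      field_simp
      ring
    have : 0 ≤ (τ * ‖x‖ - 2 * r) ^ 2 / (4 * τ) := by positivity
    linarith
  simp only [polyGauss_apply, norm_mul, Complex.norm_real, Real.norm_eq_abs, gauss, Real.abs_exp]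
  calc Real.exp (r * ‖x‖) * (‖polyEval p x‖ * Real.exp (-(τ / 2) * ‖x‖ ^ 2))
      = ‖polyEval p x‖ * Real.exp (r * ‖x‖ - τ / 2 * ‖x‖ ^ 2) := by
        rw [mul_left_comm, ← Real.exp_add, neg_mul, ← sub_eq_add_neg]
    _ ≤ ‖polyEval p x‖ * Real.exp (r ^ 2 / τ - τ / 2 / 2 * ‖x‖ ^ 2) := by gcongr
    _ = Real.exp (r ^ 2 / τ) * (‖polyEval p x‖ * Real.exp (-(τ / 2 / 2) * ‖x‖ ^ 2)) := by
        rw [mul_left_comm, ← Real.exp_add, neg_mul, ← sub_eq_add_neg]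

end Hermite

section Density

variable {ι : Type*}

/-- The polynomials that take real values on `ℝⁿ`. -/
def realPoly (ι : Type*) : Subalgebra ℝ (MvPolynomial ι ℂ) where
  carrier := {w | ∀ x, starRingEnd ℂ (polyEval w x) = polyEval w x}
  add_mem' hv hw x := by rw [map_add, Pi.add_apply, map_add, hv, hw]
  mul_mem' hv hw x := by rw [map_mul, Pi.mul_apply, map_mul, hv, hw]
  algebraMap_mem' r x := by
    rw [IsScalarTower.algebraMap_apply ℝ ℂ, MvPolynomial.algebraMap_eq, polyEval_C]
    exact Complex.conj_ofReal r

theorem C_ofReal_mem_realPoly (r : ℝ) : MvPolynomial.C (r : ℂ) ∈ realPoly ι :=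
  (realPoly ι).algebraMap_mem r

theorem X_mem_realPoly (i : ι) : MvPolynomial.X i ∈ realPoly ι := fun x => by
  rw [polyEval_X, Complex.conj_ofReal]

variable [Fintype ι]

/-- The linear form `x ↦ ⟪x, ξ⟫` as a polynomial. -/
def innerPoly (ξ : EuclideanSpace ℝ ι) : MvPolynomial ι ℂ :=
  ∑ i, MvPolynomial.C (ξ i : ℂ) * MvPolynomial.X i

theorem innerPoly_mem_realPoly (ξ : EuclideanSpace ℝ ι) : innerPoly ξ ∈ realPoly ι :=
  sum_mem fun i _ => mul_mem (C_ofReal_mem_realPoly (ξ i)) (X_mem_realPoly i)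

theorem polyEval_innerPoly (ξ x : EuclideanSpace ℝ ι) :
    polyEval (innerPoly ξ) x = (inner ℝ x ξ : ℝ) := by
  simp [innerPoly, PiLp.inner_apply]

variable {τ : ℝ}

theorem conj_polyGauss (hτ : 0 < τ) {p : MvPolynomial ι ℂ} (hp : p ∈ realPoly ι)
    (x : EuclideanSpace ℝ ι) : starRingEnd ℂ (polyGauss hτ p x) = polyGauss hτ p x := by
  rw [polyGauss_apply, map_mul, hp x, Complex.conj_ofReal]

theorem integrable_exp_mul_polyGauss_mul (hτ : 0 < τ) (r : ℝ) (p : MvPolynomial ι ℂ)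
    (u : EuclideanL2 ι) :
    Integrable fun x => (Real.exp (r * ‖x‖) : ℂ) * polyGauss hτ p x * u x :=
  (memLp_exp_mul_polyGauss hτ r p).integrable_mul (Lp.memLp u)

theorem integrable_polyGauss_mul (hτ : 0 < τ) (p : MvPolynomial ι ℂ) (u : EuclideanL2 ι) :
    Integrable fun x => polyGauss hτ p x * u x := by
  simpa using integrable_exp_mul_polyGauss_mul hτ 0 p u

theorem polyEval_mul_ae_eq_of_inner_eq (hτ : 0 < τ) {w : MvPolynomial ι ℂ}
    (hw : w ∈ realPoly ι) {u f : EuclideanL2 ι}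
    (h : ∀ p, ⟪hermite hτ (w * p), u⟫_ℂ = ⟪hermite hτ p, f⟫_ℂ) :
    (fun x => polyEval w x * u x) =ᵐ[volume] f := by
  let g (x : EuclideanSpace ℝ ι) : ℂ := polyGauss hτ w x * u x - polyGauss hτ 1 x * f x
  have g_ae_eq_zero : g =ᵐ[volume] 0 := by
    refine ae_eq_zero_of_moments_eq_zero (fun r => ?_) fun ξ n => ?_
    · refine ((integrable_exp_mul_polyGauss_mul hτ r w u).sub
        (integrable_exp_mul_polyGauss_mul hτ r 1 f)).congr (.of_forall fun x => ?_)
      simp only [g, Pi.sub_apply, Complex.real_smul]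
      ring
    · have power_real : innerPoly ξ ^ n ∈ realPoly ι := pow_mem (innerPoly_mem_realPoly ξ) n
      have moment_integrand (x : EuclideanSpace ℝ ι) : (inner ℝ x ξ ^ n : ℝ) • g x =
          polyGauss hτ (w * innerPoly ξ ^ n) x * u x - polyGauss hτ (innerPoly ξ ^ n) x * f x := by
        simp only [g, polyGauss_apply, map_mul, map_pow, map_one, Pi.mul_apply, Pi.pow_apply,
          Pi.one_apply, polyEval_innerPoly, Complex.real_smul, Complex.ofReal_pow]
        ring
      have h_power := h (innerPoly ξ ^ n)
      simp only [inner_hermite, conj_polyGauss hτ (mul_mem hw power_real),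
        conj_polyGauss hτ power_real] at h_power
      simp only [moment_integrand]
      rw [integral_sub (integrable_polyGauss_mul hτ _ _) (integrable_polyGauss_mul hτ _ _),
        h_power, sub_self]
  filter_upwards [g_ae_eq_zero] with x hx
  have gauss_ne_zero : (gauss τ x : ℂ) ≠ 0 := mod_cast (gauss_pos τ x).ne'
  simp only [g, polyGauss_apply, map_one, Pi.one_apply, Pi.zero_apply] at hx
  exact mul_left_cancel₀ gauss_ne_zero (by linear_combination hx)

theorem denseRange_hermite (hτ : 0 < τ) :
    DenseRange (hermite hτ : MvPolynomial ι ℂ → EuclideanL2 ι) := by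
  rw [DenseRange, ← LinearMap.coe_range, Submodule.dense_iff_topologicalClosure_eq_top,
    Submodule.topologicalClosure_eq_top_iff, Submodule.eq_bot_iff]
  intro u hu
  have orthogonal (p : MvPolynomial ι ℂ) : ⟪hermite hτ (1 * p), u⟫_ℂ = ⟪hermite hτ p, 0⟫_ℂ := by
    rw [one_mul, inner_zero_right]
    exact (Submodule.mem_orthogonal _ _).mp hu _ ⟨p, rfl⟩
  refine Lp.ext ?_
  filter_upwards [polyEval_mul_ae_eq_of_inner_eq hτ (one_mem _) orthogonal] with x hx
  simpa using hx

end Density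

section InnerProduct

variable {H : Type*} [NormedAddCommGroup H] [InnerProductSpace ℂ H]

theorem norm_le_norm_add_of_re_inner_nonneg {u v : H} (h : 0 ≤ (⟪u, v⟫_ℂ).re) :
    ‖u‖ ≤ ‖u + v‖ := by
  refine le_of_sq_le_sq ?_ (norm_nonneg _)
  have expand : ‖u + v‖ ^ 2 = ‖u‖ ^ 2 + 2 * (⟪u, v⟫_ℂ).re + ‖v‖ ^ 2 := norm_add_sq (𝕜 := ℂ) u v
  have := sq_nonneg ‖v‖
  linarith

theorem re_inner_self (u : H) : (⟪u, u⟫_ℂ).re = ‖u‖ ^ 2 :=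
  inner_self_eq_norm_sq (𝕜 := ℂ) u

end InnerProduct

section Oscillator

open MvPolynomial (pderiv)

variable {ι : Type*} [Fintype ι] {τ : ℝ}

theorem inner_hermite_mul_left (hτ : 0 < τ) {w : MvPolynomial ι ℂ} (hw : w ∈ realPoly ι)
    (p q : MvPolynomial ι ℂ) :
    ⟪hermite hτ (w * p), hermite hτ q⟫_ℂ = ⟪hermite hτ p, hermite hτ (w * q)⟫_ℂ := by
  rw [inner_hermite, inner_hermite]
  refine integral_congr_ae ?_
  filter_upwards [coeFn_hermite hτ q, coeFn_hermite hτ (w * q)] with x hq hwq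
  simp only [hq, hwq, polyGauss_apply, map_mul, Pi.mul_apply, hw x]
  ring

theorem im_inner_hermite_mul_self (hτ : 0 < τ) {w : MvPolynomial ι ℂ} (hw : w ∈ realPoly ι)
    (p : MvPolynomial ι ℂ) : (⟪hermite hτ p, hermite hτ (w * p)⟫_ℂ).im = 0 := by
  rw [← Complex.conj_eq_iff_im, inner_conj_symm, inner_hermite_mul_left hτ hw]

theorem inner_hermite_gaussDeriv_left (hτ : 0 < τ) (j : ι) (p q : MvPolynomial ι ℂ) :
    ⟪hermite hτ (gaussDeriv τ j p), hermite hτ q⟫_ℂ =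
      -⟪hermite hτ p, hermite hτ (gaussDeriv τ j q)⟫_ℂ := by
  simp only [hermite_apply, ← lineDeriv_polyGauss]
  exact inner_lineDeriv_toLp_left _ _ _

/-- The polynomial `|x|²`. -/
def normSqPoly (ι : Type*) [Fintype ι] : MvPolynomial ι ℂ := ∑ j, MvPolynomial.X j ^ 2

theorem normSqPoly_mem_realPoly : normSqPoly ι ∈ realPoly ι :=
  sum_mem fun j _ => pow_mem (X_mem_realPoly j) 2

theorem polyEval_normSqPoly (x : EuclideanSpace ℝ ι) :
    polyEval (normSqPoly ι) x = (‖x‖ ^ 2 : ℝ) := by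
  simp [normSqPoly, EuclideanSpace.norm_sq_eq]

theorem pderiv_normSqPoly (j : ι) : pderiv j (normSqPoly ι) = 2 * MvPolynomial.X j := by
  classical
  simp [normSqPoly, Derivation.leibniz_pow, MvPolynomial.pderiv_X, Pi.single_apply]

/-- The operator on polynomials which is the Laplacian conjugated by the Gaussian. -/
def lapPoly (τ : ℝ) : Module.End ℂ (MvPolynomial ι ℂ) := ∑ j, gaussDeriv τ j ∘ₗ gaussDeriv τ j

/-- The operator on polynomials which is `-Δ + τ² |x|²` conjugated by the Gaussian. -/
def oscPoly (τ : ℝ) : Module.End ℂ (MvPolynomial ι ℂ) :=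
  -lapPoly τ + ((τ ^ 2 : ℝ) : ℂ) • LinearMap.mulLeft ℂ (normSqPoly ι)

theorem lapPoly_apply (τ : ℝ) (p : MvPolynomial ι ℂ) :
    lapPoly τ p = ∑ j, gaussDeriv τ j (gaussDeriv τ j p) := by
  simp [lapPoly]

theorem oscPoly_apply (τ : ℝ) (p : MvPolynomial ι ℂ) :
    oscPoly τ p = -lapPoly τ p + ((τ ^ 2 : ℝ) : ℂ) • (normSqPoly ι * p) := rfl

theorem inner_hermite_lapPoly_left (hτ : 0 < τ) (p q : MvPolynomial ι ℂ) :
    ⟪hermite hτ (lapPoly τ p), hermite hτ q⟫_ℂ =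
      -∑ j, ⟪hermite hτ (gaussDeriv τ j p), hermite hτ (gaussDeriv τ j q)⟫_ℂ := by
  simp only [lapPoly_apply, map_sum, sum_inner, inner_hermite_gaussDeriv_left hτ _ _ q,
    Finset.sum_neg_distrib]

theorem inner_hermite_oscPoly_left (hτ : 0 < τ) (p q : MvPolynomial ι ℂ) :
    ⟪hermite hτ (oscPoly τ p), hermite hτ q⟫_ℂ =
      ∑ j, ⟪hermite hτ (gaussDeriv τ j p), hermite hτ (gaussDeriv τ j q)⟫_ℂ +
        (τ ^ 2 : ℝ) * ⟪hermite hτ p, hermite hτ (normSqPoly ι * q)⟫_ℂ := by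
  rw [oscPoly_apply, map_add, inner_add_left, map_neg, inner_neg_left, inner_hermite_lapPoly_left,
    neg_neg, map_smul, inner_smul_left, Complex.conj_ofReal,
    inner_hermite_mul_left hτ normSqPoly_mem_realPoly]

theorem inner_hermite_oscPoly_symm (hτ : 0 < τ) (p q : MvPolynomial ι ℂ) :
    ⟪hermite hτ (oscPoly τ p), hermite hτ q⟫_ℂ = ⟪hermite hτ p, hermite hτ (oscPoly τ q)⟫_ℂ := by
  rw [← inner_conj_symm (hermite hτ p), inner_hermite_oscPoly_left, inner_hermite_oscPoly_left]
  simp [inner_hermite_mul_left hτ normSqPoly_mem_realPoly]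

theorem inner_hermite_normSqPoly_self (hτ : 0 < τ) (p : MvPolynomial ι ℂ) :
    ⟪hermite hτ p, hermite hτ (normSqPoly ι * p)⟫_ℂ =
      ((∑ j, ‖hermite hτ (MvPolynomial.X j * p)‖ ^ 2 : ℝ) : ℂ) := by
  rw [normSqPoly, Finset.sum_mul, map_sum, inner_sum, Complex.ofReal_sum]
  refine Finset.sum_congr rfl fun j _ => ?_
  rw [pow_two, mul_assoc, ← inner_hermite_mul_left hτ (X_mem_realPoly j), Complex.ofReal_pow]
  exact inner_self_eq_norm_sq_to_K _

theorem re_inner_hermite_oscPoly_self (hτ : 0 < τ) (p : MvPolynomial ι ℂ) :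
    (⟪hermite hτ p, hermite hτ (oscPoly τ p)⟫_ℂ).re =
      ∑ j, ‖hermite hτ (gaussDeriv τ j p)‖ ^ 2 +
        τ ^ 2 * ∑ j, ‖hermite hτ (MvPolynomial.X j * p)‖ ^ 2 := by
  rw [← inner_hermite_oscPoly_symm, inner_hermite_oscPoly_left, inner_hermite_normSqPoly_self,
    Complex.add_re, Complex.re_sum, Complex.re_ofReal_mul, Complex.ofReal_re]
  simp only [re_inner_self]

theorem sum_norm_sq_gaussDeriv_le (hτ : 0 < τ) (p : MvPolynomial ι ℂ) :
    ∑ j, ‖hermite hτ (gaussDeriv τ j p)‖ ^ 2 ≤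
      (⟪hermite hτ p, hermite hτ (oscPoly τ p)⟫_ℂ).re := by
  rw [re_inner_hermite_oscPoly_self]
  exact le_add_of_nonneg_right (by positivity)

theorem re_inner_hermite_oscPoly_self_nonneg (hτ : 0 < τ) (p : MvPolynomial ι ℂ) :
    0 ≤ (⟪hermite hτ p, hermite hτ (oscPoly τ p)⟫_ℂ).re :=
  (by positivity : (0 : ℝ) ≤ _).trans (sum_norm_sq_gaussDeriv_le hτ p)

theorem re_inner_hermite_gaussDeriv_X (hτ : 0 < τ) (j : ι) (p : MvPolynomial ι ℂ) :
    2 * (⟪hermite hτ (gaussDeriv τ j p), hermite hτ (MvPolynomial.X j * p)⟫_ℂ).re =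
      -‖hermite hτ p‖ ^ 2 := by
  have by_parts := inner_hermite_gaussDeriv_left hτ j p (MvPolynomial.X j * p)
  rw [gaussDeriv_mul, MvPolynomial.pderiv_X_self, one_mul, map_add, inner_add_right,
    ← inner_hermite_mul_left hτ (X_mem_realPoly j) p,
    ← inner_conj_symm (hermite hτ (MvPolynomial.X j * p))] at by_parts
  have real_part := congrArg Complex.re by_parts
  simp only [Complex.neg_re, Complex.add_re, Complex.conj_re, re_inner_self] at real_part
  linarith

theorem re_inner_hermite_gaussDeriv_normSqPoly_ge (hτ : 0 < τ) (j : ι) (p : MvPolynomial ι ℂ) :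
    -‖hermite hτ p‖ ^ 2 ≤ (⟪hermite hτ (gaussDeriv τ j p),
      hermite hτ (gaussDeriv τ j (normSqPoly ι * p))⟫_ℂ).re := by
  rw [gaussDeriv_mul, pderiv_normSqPoly, two_mul, add_mul, map_add, map_add, inner_add_right,
    inner_add_right, ← two_mul, inner_hermite_normSqPoly_self, Complex.add_re, Complex.ofReal_re,
    ← re_inner_hermite_gaussDeriv_X hτ j p, ← Complex.ofReal_ofNat, Complex.re_ofReal_mul]
  exact le_add_of_nonneg_right (by positivity)

theorem re_inner_hermite_lapPoly_normSqPoly_le (hτ : 0 < τ) (p : MvPolynomial ι ℂ) :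
    (⟪hermite hτ (lapPoly τ p), hermite hτ (normSqPoly ι * p)⟫_ℂ).re ≤
      Fintype.card ι * ‖hermite hτ p‖ ^ 2 := by
  rw [inner_hermite_lapPoly_left, Complex.neg_re, Complex.re_sum, neg_le, ← mul_neg,
    ← nsmul_eq_mul, ← Finset.card_univ]
  exact Finset.card_nsmul_le_sum _ _ _ fun j _ =>
    re_inner_hermite_gaussDeriv_normSqPoly_ge hτ j p

theorem norm_sq_lapPoly_add_norm_sq_normSqPoly_le (hτ : 0 < τ) (p : MvPolynomial ι ℂ) :
    ‖hermite hτ (lapPoly τ p)‖ ^ 2 + (τ ^ 2 * ‖hermite hτ (normSqPoly ι * p)‖) ^ 2 ≤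
      (1 + 2 * τ ^ 2 * Fintype.card ι) * ‖hermite hτ ((oscPoly τ + 1) p)‖ ^ 2 := by
  have expand : ‖hermite hτ (oscPoly τ p)‖ ^ 2 = ‖hermite hτ (lapPoly τ p)‖ ^ 2 -
      2 * (τ ^ 2 * (⟪hermite hτ (lapPoly τ p), hermite hτ (normSqPoly ι * p)⟫_ℂ).re) +
        (τ ^ 2 * ‖hermite hτ (normSqPoly ι * p)‖) ^ 2 := by
    have := norm_sub_sq (𝕜 := ℂ) (hermite hτ (lapPoly τ p))
      (((τ ^ 2 : ℝ) : ℂ) • hermite hτ (normSqPoly ι * p))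
    rwa [norm_smul, Complex.norm_of_nonneg (sq_nonneg τ), inner_smul_right, RCLike.re_eq_complex_re,
      Complex.re_ofReal_mul, ← norm_neg, neg_sub, sub_eq_neg_add, ← map_smul, ← map_neg, ← map_add,
      ← oscPoly_apply] at this
  have re_inner_nonneg := re_inner_hermite_oscPoly_self_nonneg hτ p
  have norm_le : ‖hermite hτ p‖ ≤ ‖hermite hτ ((oscPoly τ + 1) p)‖ := by
    rw [LinearMap.add_apply, Module.End.one_apply, map_add, add_comm]
    exact norm_le_norm_add_of_re_inner_nonneg re_inner_nonneg
  have norm_osc_le : ‖hermite hτ (oscPoly τ p)‖ ≤ ‖hermite hτ ((oscPoly τ + 1) p)‖ := by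
    rw [LinearMap.add_apply, Module.End.one_apply, map_add]
    refine norm_le_norm_add_of_re_inner_nonneg ?_
    rwa [inner_hermite_oscPoly_symm]
  calc ‖hermite hτ (lapPoly τ p)‖ ^ 2 + (τ ^ 2 * ‖hermite hτ (normSqPoly ι * p)‖) ^ 2
      = ‖hermite hτ (oscPoly τ p)‖ ^ 2 + 2 * τ ^ 2 *
          (⟪hermite hτ (lapPoly τ p), hermite hτ (normSqPoly ι * p)⟫_ℂ).re := by
        rw [expand]; ring
    _ ≤ ‖hermite hτ ((oscPoly τ + 1) p)‖ ^ 2 + 2 * τ ^ 2 *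
          (Fintype.card ι * ‖hermite hτ ((oscPoly τ + 1) p)‖ ^ 2) := by
        gcongr
        exact (re_inner_hermite_lapPoly_normSqPoly_le hτ p).trans (by gcongr)
    _ = _ := by ring

theorem norm_hermite_lapPoly_le (hτ : 0 < τ) (p : MvPolynomial ι ℂ) :
    ‖hermite hτ (lapPoly τ p)‖ ≤
      √(1 + 2 * τ ^ 2 * Fintype.card ι) * ‖hermite hτ ((oscPoly τ + 1) p)‖ := by
  refine le_of_sq_le_sq ?_ (by positivity)
  rw [mul_pow, Real.sq_sqrt (by positivity)]
  exact (le_add_of_nonneg_right (sq_nonneg _)).trans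
    (norm_sq_lapPoly_add_norm_sq_normSqPoly_le hτ p)

theorem norm_hermite_normSqPoly_mul_le (hτ : 0 < τ) (p : MvPolynomial ι ℂ) :
    ‖hermite hτ (normSqPoly ι * p)‖ ≤
      (τ ^ 2)⁻¹ * √(1 + 2 * τ ^ 2 * Fintype.card ι) * ‖hermite hτ ((oscPoly τ + 1) p)‖ := by
  rw [mul_assoc, le_inv_mul_iff₀ (by positivity)]
  refine le_of_sq_le_sq ?_ (by positivity)
  rw [mul_pow √_, Real.sq_sqrt (by positivity)]
  exact (le_add_of_nonneg_left (sq_nonneg _)).trans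
    (norm_sq_lapPoly_add_norm_sq_normSqPoly_le hτ p)

theorem im_inner_hermite_oscPoly_mul (hτ : 0 < τ) {w : MvPolynomial ι ℂ} (hw : w ∈ realPoly ι)
    (p : MvPolynomial ι ℂ) :
    (⟪hermite hτ ((oscPoly τ + 1) p), hermite hτ (w * p)⟫_ℂ).im =
      ∑ j, (⟪hermite hτ (gaussDeriv τ j p), hermite hτ (pderiv j w * p)⟫_ℂ).im := by
  rw [LinearMap.add_apply, Module.End.one_apply, map_add, inner_add_left, Complex.add_im,
    im_inner_hermite_mul_self hτ hw, inner_hermite_oscPoly_left, Complex.add_im,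
    Complex.im_ofReal_mul, ← mul_assoc,
    im_inner_hermite_mul_self hτ (mul_mem normSqPoly_mem_realPoly hw), mul_zero, add_zero, add_zero,
    Complex.im_sum]
  refine Finset.sum_congr rfl fun j _ => ?_
  rw [gaussDeriv_mul, map_add, inner_add_right, Complex.add_im, im_inner_hermite_mul_self hτ hw,
    add_zero]

end Oscillator

section DegreeFlag

open MvPolynomial (pderiv)

variable {ι : Type*}

/-- The polynomials of degree less than `N`. -/
def polyFlag (ι : Type*) (N : ℕ) : Submodule ℂ (MvPolynomial ι ℂ) :=
  MvPolynomial.restrictSupport ℂ {s | s.degree < N}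

theorem monomial_mem_polyFlag {N : ℕ} {s : ι →₀ ℕ} (hs : s.degree < N) (c : ℂ) :
    MvPolynomial.monomial s c ∈ polyFlag ι N := by
  rw [polyFlag, MvPolynomial.monomial_mem_restrictSupport]
  exact .inl hs

theorem polyFlag_zero : polyFlag ι 0 = ⊥ := by
  simp [polyFlag, MvPolynomial.restrictSupport_eq_span]

theorem polyFlag_mono : Monotone (polyFlag ι) := fun _ _ hNM =>
  MvPolynomial.restrictSupport_mono ℂ fun _ hs => lt_of_lt_of_le hs hNM

theorem exists_mem_polyFlag (p : MvPolynomial ι ℂ) : ∃ N, p ∈ polyFlag ι N :=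
  ⟨p.totalDegree + 1, (MvPolynomial.mem_restrictSupport_iff ℂ).mpr fun _ hs =>
    Nat.lt_succ_of_le (MvPolynomial.le_totalDegree hs)⟩

theorem pderiv_pderiv_monomial_mem_polyFlag {N : ℕ} {s : ι →₀ ℕ} (hs : s.degree ≤ N) (j : ι)
    (c : ℂ) : pderiv j (pderiv j (MvPolynomial.monomial s c)) ∈ polyFlag ι N := by
  rw [MvPolynomial.pderiv_monomial, MvPolynomial.pderiv_monomial]
  by_cases h : s j = 0
  · simp [h]
  · refine monomial_mem_polyFlag ?_ _
    have degree_split := congrArg Finsupp.degree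
      (tsub_add_cancel_of_le (by simpa using Nat.one_le_iff_ne_zero.mpr h : Finsupp.single j 1 ≤ s))
    rw [map_add, Finsupp.degree_single] at degree_split
    have degree_le := Finsupp.degree_mono
      (tsub_le_self : s - Finsupp.single j 1 - Finsupp.single j 1 ≤ s - Finsupp.single j 1)
    omega

instance finiteDimensional_polyFlag [Finite ι] (N : ℕ) : FiniteDimensional ℂ (polyFlag ι N) :=
  have : Finite {s : ι →₀ ℕ | s.degree < N} :=
    (Finsupp.finite_of_degree_le N).subset fun _ hs => Set.mem_ofPred.mpr (le_of_lt hs)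
  Module.Finite.of_basis (MvPolynomial.basisRestrictSupport ℂ _)

variable [Fintype ι]

theorem oscPoly_eq (τ : ℝ) (p : MvPolynomial ι ℂ) :
    oscPoly τ p = ((Fintype.card ι * τ : ℝ) : ℂ) • p +
      ((2 * τ : ℝ) : ℂ) • ∑ j, MvPolynomial.X j * pderiv j p - ∑ j, pderiv j (pderiv j p) := by
  have summand (j : ι) : gaussDeriv τ j (gaussDeriv τ j p) = pderiv j (pderiv j p) -
      MvPolynomial.C ((2 * τ : ℝ) : ℂ) * (MvPolynomial.X j * pderiv j p) -
      MvPolynomial.C (τ : ℂ) * p +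
      MvPolynomial.C ((τ ^ 2 : ℝ) : ℂ) * (MvPolynomial.X j ^ 2 * p) := by
    simp only [gaussDeriv_apply, map_sub, Derivation.leibniz, smul_eq_mul, MvPolynomial.pderiv_C,
      MvPolynomial.pderiv_X_self, Complex.ofReal_mul, Complex.ofReal_pow, Complex.ofReal_ofNat,
      map_mul, map_pow, map_ofNat]
    ring
  simp only [oscPoly_apply, lapPoly_apply, summand, normSqPoly, MvPolynomial.smul_eq_C_mul,
    Finset.sum_add_distrib, Finset.sum_sub_distrib, Finset.mul_sum, Finset.sum_mul,
    Finset.sum_const, Finset.card_univ, nsmul_eq_mul, Complex.ofReal_mul, Complex.ofReal_natCast,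
    map_mul, map_natCast]
  ring

theorem sum_X_mul_pderiv_monomial (s : ι →₀ ℕ) (c : ℂ) :
    ∑ j, MvPolynomial.X j * pderiv j (MvPolynomial.monomial s c) =
      (s.degree : ℂ) • MvPolynomial.monomial s c := by
  simp only [MvPolynomial.X_mul_pderiv_monomial, ← Finset.sum_smul, ← Finsupp.degree_eq_sum,
    Nat.cast_smul_eq_nsmul]

theorem oscPoly_add_one_sub_smul_mem_polyFlag (τ : ℝ) (N : ℕ) {p : MvPolynomial ι ℂ}
    (hp : p ∈ polyFlag ι (N + 1)) :
    (oscPoly τ + 1) p - ((2 * τ * N + (Fintype.card ι * τ + 1) : ℝ) : ℂ) • p ∈ polyFlag ι N := by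
  suffices polyFlag ι (N + 1) ≤ (polyFlag ι N).comap
      (oscPoly τ + 1 - ((2 * τ * N + (Fintype.card ι * τ + 1) : ℝ) : ℂ) • 1) from this hp
  rw [polyFlag, MvPolynomial.restrictSupport_eq_span, Submodule.span_le]
  rintro _ ⟨s, hs, rfl⟩
  have hs' : s.degree ≤ N := Nat.lt_succ_iff.mp hs
  have remainder : (oscPoly τ + 1 - ((2 * τ * N + (Fintype.card ι * τ + 1) : ℝ) : ℂ) • 1)
      (MvPolynomial.monomial s 1) =
      (2 * τ * (s.degree - N) : ℂ) • MvPolynomial.monomial s 1 -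
        ∑ j, pderiv j (pderiv j (MvPolynomial.monomial s 1)) := by
    simp only [LinearMap.sub_apply, LinearMap.add_apply, LinearMap.smul_apply, Module.End.one_apply,
      oscPoly_eq, sum_X_mul_pderiv_monomial]
    push_cast
    module
  rw [SetLike.mem_coe, Submodule.mem_comap, remainder]
  refine sub_mem ?_ (sum_mem fun j _ => pderiv_pderiv_monomial_mem_polyFlag hs' j 1)
  rcases hs'.lt_or_eq with h | h
  · exact Submodule.smul_mem _ _ (monomial_mem_polyFlag h 1)
  · simp [h]

variable {τ : ℝ}

theorem oscPoly_add_one_surjective (hτ : 0 < τ) :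
    Function.Surjective (oscPoly τ + 1 : Module.End ℂ (MvPolynomial ι ℂ)) := fun p => by
  obtain ⟨N, hN⟩ := exists_mem_polyFlag p
  obtain ⟨q, -, hq⟩ := exists_map_eq_of_triangular polyFlag_mono polyFlag_zero
    (fun N => Complex.ofReal_ne_zero.mpr (by positivity))
    (fun N p hp => oscPoly_add_one_sub_smul_mem_polyFlag τ N hp) hN
  exact ⟨q, hq⟩

theorem isSelfAdjointCore_hermite (hτ : 0 < τ) :
    IsSelfAdjointCore (P := MvPolynomial ι ℂ) (hermite hτ) (oscPoly τ + 1) where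
  denseRange := denseRange_hermite hτ
  surjective := oscPoly_add_one_surjective hτ
  inner_symm p q := by
    simp only [LinearMap.add_apply, Module.End.one_apply, map_add, inner_add_left, inner_add_right,
      inner_hermite_oscPoly_symm]
  norm_sq_le_inner p := by
    rw [LinearMap.add_apply, Module.End.one_apply, map_add, inner_add_right, Complex.add_re,
      re_inner_self]
    exact le_add_of_nonneg_left (re_inner_hermite_oscPoly_self_nonneg hτ p)

/-- The resolvent `(1 + S)⁻¹` of the harmonic oscillator `S = -Δ + τ² |x|²`. -/
abbrev oscResolvent (hτ : 0 < τ) :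
    EuclideanL2 ι →L[ℂ] EuclideanL2 ι :=
  relOp (hermite hτ) (oscPoly τ + 1) 1

theorem isCompactOperator_oscResolvent (hτ : 0 < τ) :
    IsCompactOperator (oscResolvent (ι := ι) hτ) := by
  refine (isSelfAdjointCore_hermite hτ).isCompactOperator_relOp_one polyFlag_mono polyFlag_zero
    exists_mem_polyFlag (fun N => by positivity) (fun N M hNM => ?_) ?_
    (fun N p hp => oscPoly_add_one_sub_smul_mem_polyFlag τ N hp)
  · gcongr
  · exact Filter.tendsto_atTop_add_const_right _ _
      (tendsto_natCast_atTop_atTop.const_mul_atTop (by positivity))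

end DegreeFlag

section GradientBound

open MvPolynomial (pderiv)

variable {ι : Type*} [Fintype ι] {τ : ℝ}

theorem norm_hermite_mul_le (hτ : 0 < τ) {q : MvPolynomial ι ℂ} {a c : ℝ} (ha : 0 ≤ a) (hc : 0 ≤ c)
    (hq : ∀ x, ‖polyEval q x‖ ≤ a * ‖x‖ ^ 2 + c) (p : MvPolynomial ι ℂ) :
    ‖hermite hτ (q * p)‖ ≤ (a * ((τ ^ 2)⁻¹ * √(1 + 2 * τ ^ 2 * Fintype.card ι)) + c) *
      ‖hermite hτ ((oscPoly τ + 1) p)‖ := by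
  let r : MvPolynomial ι ℂ := (a : ℂ) • (normSqPoly ι * p) + (c : ℂ) • p
  have norm_le_majorant : ‖hermite hτ (q * p)‖ ≤ ‖hermite hτ r‖ := by
    refine Lp.norm_le_norm_of_ae_le ?_
    filter_upwards [coeFn_hermite hτ (q * p), coeFn_hermite hτ r] with x hqp hr
    have majorant_nonneg : 0 ≤ a * ‖x‖ ^ 2 + c := by positivity
    have polyEval_r : polyEval r x = ((a * ‖x‖ ^ 2 + c : ℝ) : ℂ) * polyEval p x := by
      simp only [r, map_add, map_smul, map_mul, Pi.add_apply, Pi.smul_apply, Pi.mul_apply,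
        smul_eq_mul, polyEval_normSqPoly, Complex.ofReal_add, Complex.ofReal_mul]
      ring
    rw [hqp, hr, polyGauss_apply, polyGauss_apply, map_mul, Pi.mul_apply, polyEval_r, norm_mul,
      norm_mul, norm_mul, norm_mul, Complex.norm_of_nonneg majorant_nonneg]
    gcongr
    exact hq x
  calc ‖hermite hτ (q * p)‖
      ≤ a * ‖hermite hτ (normSqPoly ι * p)‖ + c * ‖hermite hτ p‖ := by
        refine norm_le_majorant.trans ?_
        rw [map_add, map_smul, map_smul]
        refine (norm_add_le _ _).trans_eq ?_
        rw [norm_smul, norm_smul, Complex.norm_of_nonneg ha, Complex.norm_of_nonneg hc]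
    _ ≤ _ := by
        rw [add_mul, mul_assoc a]
        gcongr
        · exact norm_hermite_normSqPoly_mul_le hτ p
        · exact (isSelfAdjointCore_hermite hτ).norm_le p

theorem norm_hermite_gaussDeriv_le (hτ : 0 < τ) (j : ι) (p : MvPolynomial ι ℂ) :
    ‖hermite hτ (gaussDeriv τ j p)‖ ≤
      √(⟪hermite hτ p, hermite hτ ((oscPoly τ + 1) p)⟫_ℂ).re := by
  refine Real.le_sqrt_of_sq_le ?_
  rw [LinearMap.add_apply, Module.End.one_apply, map_add, inner_add_right, Complex.add_re,
    re_inner_self]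
  refine le_add_of_le_of_nonneg ?_ (sq_nonneg _)
  exact (Finset.single_le_sum (f := fun j => ‖hermite hτ (gaussDeriv τ j p)‖ ^ 2)
    (fun _ _ => sq_nonneg _) (Finset.mem_univ j)).trans (sum_norm_sq_gaussDeriv_le hτ p)

/-- The commutator of `-Δ + τ²|x|²` with multiplication by `w` is of first order, with coefficients
controlled by the gradient of `w`. -/
theorem abs_im_inner_hermite_mul_le (hτ : 0 < τ) {w : MvPolynomial ι ℂ} (hw : w ∈ realPoly ι)
    {C : ℝ} (hC : ∀ j p, ‖hermite hτ (pderiv j w * p)‖ ≤ C * ‖hermite hτ ((oscPoly τ + 1) p)‖)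
    (p : MvPolynomial ι ℂ) :
    |(⟪hermite hτ ((oscPoly τ + 1) p), hermite hτ (w * p)⟫_ℂ).im| ≤
      Fintype.card ι * C * √(⟪hermite hτ p, hermite hτ ((oscPoly τ + 1) p)⟫_ℂ).re *
        ‖hermite hτ ((oscPoly τ + 1) p)‖ := by
  rw [im_inner_hermite_oscPoly_mul hτ hw]
  refine (Finset.abs_sum_le_sum_abs _ _).trans ((Finset.sum_le_card_nsmul _ _
    (√(⟪hermite hτ p, hermite hτ ((oscPoly τ + 1) p)⟫_ℂ).re *
      (C * ‖hermite hτ ((oscPoly τ + 1) p)‖)) fun j _ => ?_).trans_eq ?_)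
  · refine (Complex.abs_im_le_norm _).trans ((norm_inner_le_norm _ _).trans ?_)
    gcongr
    exacts [norm_hermite_gaussDeriv_le hτ j p, hC j p]
  · rw [Finset.card_univ, nsmul_eq_mul]
    ring

theorem exists_solution_osc_add_mul (hτ : 0 < τ) {w : MvPolynomial ι ℂ} (hw : w ∈ realPoly ι)
    {a c : ℝ} (ha : 0 ≤ a) (hc : 0 ≤ c)
    (h_grad : ∀ j x, ‖polyEval (pderiv j w) x‖ ≤ a * ‖x‖ ^ 2 + c) {b : ℂ} (hb : 0 < b.im) :
    ∃ l : ℝ, 0 ≤ l ∧ ∀ f : EuclideanL2 ι,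
      ∃ y g : EuclideanL2 ι,
        (fun x => polyEval w x * oscResolvent hτ y x) =ᵐ[volume] g ∧
          y + (l : ℂ) • oscResolvent hτ y + b • g = f := by
  obtain ⟨l, hl, h_solution⟩ := (isSelfAdjointCore_hermite hτ).exists_weak_solution
    (M := LinearMap.mulLeft ℂ w) (inner_hermite_mul_left hτ hw)
    (abs_im_inner_hermite_mul_le hτ hw fun j p => norm_hermite_mul_le hτ ha hc (h_grad j) p) hb
  refine ⟨l, hl, fun f => ?_⟩
  obtain ⟨y, g, hg, hf⟩ := h_solution f
  exact ⟨y, g, polyEval_mul_ae_eq_of_inner_eq hτ hw hg, hf⟩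

end GradientBound

section Cutoff

open Filter Topology
open scoped LineDeriv

variable {E : Type*} [NormedAddCommGroup E] [InnerProductSpace ℝ E]

/-- The product of `φ` and the dilation `x ↦ c (ε x)`; if `c` is a cutoff function, this is the
cutoff of `φ` at the scale `ε⁻¹`. -/
def cutoff (c : 𝓢(E, ℂ)) (ε : ℝ) (φ : 𝓢(E, ℂ)) : 𝓢(E, ℂ) :=
  SchwartzMap.smulLeftCLM ℂ (fun x => c (ε • x)) φ

theorem cutoff_apply (c : 𝓢(E, ℂ)) (ε : ℝ) (φ : 𝓢(E, ℂ)) (x : E) :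
    cutoff c ε φ x = c (ε • x) * φ x :=
  SchwartzMap.smulLeftCLM_apply_apply
    (c.hasTemperateGrowth.comp (g := c) (f := ε • ContinuousLinearMap.id ℝ E)
      (ContinuousLinearMap.hasTemperateGrowth _)) φ x

theorem coe_cutoff (c : 𝓢(E, ℂ)) (ε : ℝ) (φ : 𝓢(E, ℂ)) :
    (cutoff c ε φ : E → ℂ) = (fun x => c (ε • x)) * φ :=
  funext (cutoff_apply c ε φ)

theorem hasCompactSupport_cutoff {c : 𝓢(E, ℂ)} (hc : HasCompactSupport c) {ε : ℝ} (hε : ε ≠ 0)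
    (φ : 𝓢(E, ℂ)) : HasCompactSupport (cutoff c ε φ) := by
  have h_dilation : HasCompactSupport fun x : E => c (ε • x) :=
    hc.comp_homeomorph (Homeomorph.smulOfNeZero ε hε)
  rw [coe_cutoff]
  exact h_dilation.mul_right

theorem lineDeriv_cutoff (c : 𝓢(E, ℂ)) (ε : ℝ) (φ : 𝓢(E, ℂ)) (v : E) :
    ∂_{v} (cutoff c ε φ) = cutoff c ε (∂_{v} φ) + (ε : ℂ) • cutoff (∂_{v} c) ε φ := by
  ext x
  have h_dilation : HasFDerivAt (fun y : E => c (ε • y))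
      ((fderiv ℝ c (ε • x)).comp (ε • ContinuousLinearMap.id ℝ E)) x :=
    (c.hasFDerivAt (ε • x)).comp x (ε • ContinuousLinearMap.id ℝ E).hasFDerivAt
  rw [SchwartzMap.lineDerivOp_apply_eq_fderiv, coe_cutoff,
    (h_dilation.mul (φ.hasFDerivAt x)).fderiv]
  simp only [add_apply, smul_apply, cutoff_apply, SchwartzMap.lineDerivOp_apply_eq_fderiv,
    ContinuousLinearMap.comp_apply, ContinuousLinearMap.id_apply,
    map_smul, smul_eq_mul, Complex.real_smul]
  ring

theorem exists_norm_sub_le (c : 𝓢(E, ℂ)) : ∃ C : ℝ, 0 ≤ C ∧ ∀ x, ‖c x - c 0‖ ≤ C * ‖x‖ := by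
  obtain ⟨C, hC0, hC⟩ := c.decay 0 1
  have h_fderiv : ∀ x, ‖fderiv ℝ c x‖ ≤ C := fun x => by
    simpa only [pow_zero, one_mul, norm_iteratedFDeriv_one] using hC x
  refine ⟨C, hC0.le, fun x => ?_⟩
  simpa only [sub_zero] using Convex.norm_image_sub_le_of_norm_fderiv_le (𝕜 := ℝ)
    (fun _ _ => c.differentiableAt) (fun y _ => h_fderiv y) convex_univ
    (Set.mem_univ 0) (Set.mem_univ x)

variable [MeasurableSpace E] [BorelSpace E]
  {μ : Measure E} [μ.HasTemperateGrowth]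

theorem toLp_add (φ ψ : 𝓢(E, ℂ)) : (φ + ψ).toLp 2 μ = φ.toLp 2 μ + ψ.toLp 2 μ :=
  map_add (SchwartzMap.toLpCLM ℂ ℂ 2 μ) φ ψ

theorem toLp_smul (a : ℂ) (φ : 𝓢(E, ℂ)) : (a • φ).toLp 2 μ = a • φ.toLp 2 μ :=
  map_smul (SchwartzMap.toLpCLM ℂ ℂ 2 μ) a φ

theorem tendsto_toLp_cutoff (c φ : 𝓢(E, ℂ)) :
    Tendsto (fun ε : ℝ => (cutoff c ε φ).toLp 2 μ) (𝓝 0) (𝓝 (c 0 • φ.toLp 2 μ)) := by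
  obtain ⟨C, hC0, hC⟩ := exists_norm_sub_le c
  let ψ : 𝓢(E, ℂ) := SchwartzMap.smulLeftCLM ℂ (fun x : E => (1 + ‖x‖ ^ 2 : ℝ)) φ
  have hψ : ∀ x, ψ x = ((1 + ‖x‖ ^ 2 : ℝ) : ℂ) * φ x := fun x => by
    rw [← Complex.real_smul]
    exact SchwartzMap.smulLeftCLM_apply_apply (by fun_prop) φ x
  have h_pointwise : ∀ ε x, ‖cutoff c ε φ x - c 0 * φ x‖ ≤ C * |ε| * ‖ψ x‖ := fun ε x => calc
    ‖cutoff c ε φ x - c 0 * φ x‖ = ‖c (ε • x) - c 0‖ * ‖φ x‖ := by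
      rw [cutoff_apply, ← sub_mul, norm_mul]
    _ ≤ C * (|ε| * (1 + ‖x‖ ^ 2)) * ‖φ x‖ := by
      have := hC (ε • x)
      rw [norm_smul, Real.norm_eq_abs] at this
      refine mul_le_mul_of_nonneg_right (this.trans ?_) (norm_nonneg _)
      gcongr
      nlinarith [sq_nonneg (‖x‖ - 1)]
    _ = C * |ε| * ‖ψ x‖ := by
      rw [hψ, norm_mul, Complex.norm_real, Real.norm_of_nonneg (by positivity)]
      ring
  have h_norm : ∀ ε, ‖(cutoff c ε φ).toLp 2 μ - c 0 • φ.toLp 2 μ‖ ≤ C * |ε| * ‖ψ.toLp 2 μ‖ := by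
    intro ε
    refine Lp.norm_le_mul_norm_of_ae_le_mul ?_
    filter_upwards [Lp.coeFn_sub ((cutoff c ε φ).toLp 2 μ) (c 0 • φ.toLp 2 μ),
      Lp.coeFn_smul (c 0) (φ.toLp 2 μ), φ.coeFn_toLp 2 μ, ψ.coeFn_toLp 2 μ,
      (cutoff c ε φ).coeFn_toLp 2 μ] with x h_sub h_smul hφ hψ h_cut
    rw [h_sub, Pi.sub_apply, h_smul, Pi.smul_apply, hφ, hψ, h_cut, smul_eq_mul]
    exact h_pointwise ε x
  rw [tendsto_iff_norm_sub_tendsto_zero]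
  have h_cont : Continuous fun ε : ℝ => C * |ε| * ‖ψ.toLp 2 μ‖ := by fun_prop
  exact squeeze_zero (fun _ => norm_nonneg _) h_norm (by simpa using h_cont.tendsto 0)

theorem tendsto_toLp_lineDeriv_lineDeriv_cutoff (c φ : 𝓢(E, ℂ)) (v : E) :
    Tendsto (fun ε : ℝ => (∂_{v} (∂_{v} (cutoff c ε φ))).toLp 2 μ) (𝓝 0)
      (𝓝 (c 0 • (∂_{v} (∂_{v} φ)).toLp 2 μ)) := by
  have hε : Tendsto (fun ε : ℝ => (ε : ℂ)) (𝓝 0) (𝓝 0) := by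
    simpa using Complex.continuous_ofReal.tendsto 0
  have h_main := tendsto_toLp_cutoff (μ := μ) c (∂_{v} (∂_{v} φ))
  have h_cross := hε.smul (tendsto_toLp_cutoff (μ := μ) (∂_{v} c) (∂_{v} φ))
  have h_last := hε.smul (hε.smul (tendsto_toLp_cutoff (μ := μ) (∂_{v} (∂_{v} c)) φ))
  have h_sum := (h_main.add h_cross).add (h_cross.add h_last)
  simp only [zero_smul, add_zero] at h_sum
  refine h_sum.congr fun ε => ?_
  rw [lineDeriv_cutoff, LineDeriv.lineDerivOp_add, lineDeriv_cutoff, LineDeriv.lineDerivOp_smul,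
    lineDeriv_cutoff]
  simp only [toLp_add, toLp_smul, smul_add]

theorem tendsto_toLp_laplacian_cutoff [FiniteDimensional ℝ E] (c φ : 𝓢(E, ℂ)) :
    Tendsto (fun ε : ℝ => (Δ (cutoff c ε φ)).toLp 2 μ) (𝓝 0) (𝓝 (c 0 • (Δ φ).toLp 2 μ)) := by
  have h_laplacian : ∀ ψ : 𝓢(E, ℂ), (Δ ψ).toLp 2 μ =
      ∑ i, (∂_{stdOrthonormalBasis ℝ E i} (∂_{stdOrthonormalBasis ℝ E i} ψ)).toLp 2 μ := fun ψ => by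
    rw [SchwartzMap.laplacian_eq_sum (stdOrthonormalBasis ℝ E)]
    exact map_sum (SchwartzMap.toLpCLM ℂ ℂ 2 μ) _ _
  simp only [h_laplacian, Finset.smul_sum]
  exact tendsto_finsetSum _ fun i _ => tendsto_toLp_lineDeriv_lineDeriv_cutoff c φ _

theorem exists_hasCompactSupport_eq_one (E : Type*) [NormedAddCommGroup E] [InnerProductSpace ℝ E]
    [FiniteDimensional ℝ E] : ∃ c : 𝓢(E, ℂ), HasCompactSupport c ∧ c 0 = 1 := by
  let b : ContDiffBump (0 : E) := ⟨1, 2, one_pos, one_lt_two⟩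
  have h_supp : HasCompactSupport (Complex.ofRealCLM ∘ b) := b.hasCompactSupport.comp_left rfl
  have h_smooth : ContDiff ℝ ∞ (Complex.ofRealCLM ∘ b) :=
    Complex.ofRealCLM.contDiff.comp b.contDiff
  refine ⟨h_supp.toSchwartzMap h_smooth, h_supp, ?_⟩
  change ((b 0 : ℝ) : ℂ) = 1
  rw [b.one_of_mem_closedBall (by simp [b]), Complex.ofReal_one]

end Cutoff

section OscillatorResolvent

variable {ι : Type*} [Fintype ι] {τ : ℝ}

/-- The bounded operator `Δ (1 + S)⁻¹`, where `S = -Δ + τ² |x|²`. -/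
def lapResolvent (hτ : 0 < τ) : EuclideanL2 ι →L[ℂ] EuclideanL2 ι :=
  relOp (hermite hτ) (oscPoly τ + 1) (lapPoly τ)

/-- The bounded operator `|x|² (1 + S)⁻¹`, where `S = -Δ + τ² |x|²`. -/
def normSqResolvent (hτ : 0 < τ) : EuclideanL2 ι →L[ℂ] EuclideanL2 ι :=
  relOp (hermite hτ) (oscPoly τ + 1) (LinearMap.mulLeft ℂ (normSqPoly ι))

theorem oscResolvent_hermite (hτ : 0 < τ) (p : MvPolynomial ι ℂ) :
    oscResolvent hτ (hermite hτ ((oscPoly τ + 1) p)) = hermite hτ p :=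
  (isSelfAdjointCore_hermite hτ).relOp_one_apply p

theorem lapResolvent_hermite (hτ : 0 < τ) (p : MvPolynomial ι ℂ) :
    lapResolvent hτ (hermite hτ ((oscPoly τ + 1) p)) = hermite hτ (lapPoly τ p) :=
  (isSelfAdjointCore_hermite hτ).relOp_apply (norm_hermite_lapPoly_le hτ) p

theorem normSqResolvent_hermite (hτ : 0 < τ) (p : MvPolynomial ι ℂ) :
    normSqResolvent hτ (hermite hτ ((oscPoly τ + 1) p)) = hermite hτ (normSqPoly ι * p) :=
  (isSelfAdjointCore_hermite hτ).relOp_apply (B := LinearMap.mulLeft ℂ (normSqPoly ι))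
    (norm_hermite_normSqPoly_mul_le hτ) p

@[elab_as_elim]
theorem osc_add_one_hermite_induction (hτ : 0 < τ) {motive : EuclideanL2 ι → Prop}
    (y : EuclideanL2 ι)
    (isClosed : IsClosed {y | motive y})
    (hermite : ∀ p : MvPolynomial ι ℂ, motive (hermite hτ ((oscPoly τ + 1) p))) : motive y :=
  (isSelfAdjointCore_hermite hτ).denseRange_comp.induction_on (p := motive) y isClosed hermite

theorem neg_lapResolvent_add_normSqResolvent_add_oscResolvent (hτ : 0 < τ) (y : EuclideanL2 ι) :
    -lapResolvent hτ y + ((τ ^ 2 : ℝ) : ℂ) • normSqResolvent hτ y + oscResolvent hτ y = y := by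
  refine osc_add_one_hermite_induction hτ y ?_ fun p => ?_
  · exact isClosed_eq (by fun_prop) continuous_id
  rw [oscResolvent_hermite, lapResolvent_hermite, normSqResolvent_hermite, LinearMap.add_apply,
    oscPoly_apply, Module.End.one_apply]
  simp only [map_add, map_neg, map_smul]

theorem normSq_mul_oscResolvent (hτ : 0 < τ) (y : EuclideanL2 ι) :
    (fun x => ((‖x‖ ^ 2 : ℝ) : ℂ) * oscResolvent hτ y x) =ᵐ[volume] normSqResolvent hτ y := by
  simp only [← polyEval_normSqPoly]
  refine polyEval_mul_ae_eq_of_inner_eq hτ normSqPoly_mem_realPoly fun p => ?_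
  refine osc_add_one_hermite_induction hτ y ?_ fun q => ?_
  · exact isClosed_eq (by fun_prop) (by fun_prop)
  rw [oscResolvent_hermite, normSqResolvent_hermite,
    inner_hermite_mul_left hτ normSqPoly_mem_realPoly]

theorem inner_hermite_mul_eq_of_ae_eq (hτ : 0 < τ) {w : MvPolynomial ι ℂ} (hw : w ∈ realPoly ι)
    {u f : EuclideanL2 ι} (h : (fun x => polyEval w x * u x) =ᵐ[volume] f) (p : MvPolynomial ι ℂ) :
    ⟪hermite hτ (w * p), u⟫_ℂ = ⟪hermite hτ p, f⟫_ℂ := by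
  rw [inner_hermite, inner_hermite]
  refine integral_congr_ae ?_
  filter_upwards [h] with x hx
  rw [← hx, polyGauss_apply, polyGauss_apply, map_mul polyEval, Pi.mul_apply]
  simp only [map_mul, hw x]
  ring

end OscillatorResolvent

section PlaneOperators

theorem mem_mulOp_graph_iff {v : Plane → ℝ} {u f : L2} :
    (u, f) ∈ (mulOp v).graph ↔ (fun x => (v x : ℂ) * u x) =ᵐ[volume] f := by
  rw [LinearPMap.mem_graph_iff]
  constructor
  · rintro ⟨y, rfl, rfl⟩
    exact (memLp_of_mem_mulDomain y.2).coeFn_toLp.symm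
  · intro h
    have hu : u ∈ mulDomain v := (Lp.memLp f).ae_eq h.symm
    exact ⟨⟨u, hu⟩, rfl, Lp.ext ((memLp_of_mem_mulDomain hu).coeFn_toLp.trans h)⟩

theorem im_inner_eq_zero_of_mem_mulOp_graph {v : Plane → ℝ} {u f : L2}
    (h : (u, f) ∈ (mulOp v).graph) : (⟪u, f⟫_ℂ).im = 0 := by
  rw [← Complex.conj_eq_iff_im, L2.inner_def, ← integral_conj]
  refine integral_congr_ae ?_
  filter_upwards [mem_mulOp_graph_iff.mp h] with x hx
  rw [RCLike.inner_apply, ← hx]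
  simp only [map_mul, Complex.conj_conj, Complex.conj_ofReal]
  ring

theorem mem_laplacianGraph_iff {u d : L2} :
    (u, d) ∈ laplacianGraph ↔ Δ (u : 𝓢'(Plane, ℂ)) = (d : 𝓢'(Plane, ℂ)) := Iff.rfl

theorem toLp_mem_laplacianGraph (φ : 𝓢(Plane, ℂ)) :
    (φ.toLp 2 volume, (Δ φ).toLp 2 volume) ∈ laplacianGraph := by
  rw [mem_laplacianGraph_iff, Lp.toTemperedDistribution_toLp_eq, Lp.toTemperedDistribution_toLp_eq,
    TemperedDistribution.laplacian_toTemperedDistributionCLM_eq]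

theorem isClosed_laplacianGraph : IsClosed (laplacianGraph : Set (L2 × L2)) := by
  have h_laplacian : Continuous fun p : L2 × L2 => Δ (p.1 : 𝓢'(Plane, ℂ)) := by
    simp only [← Lp.toTemperedDistributionCLM_apply, ← TemperedDistribution.laplacianCLM_apply]
    fun_prop
  have h_coe : Continuous fun p : L2 × L2 => (p.2 : 𝓢'(Plane, ℂ)) := by
    simp only [← Lp.toTemperedDistributionCLM_apply]
    fun_prop
  exact isClosed_eq h_laplacian h_coe

theorem integral_laplacian_mul_eq {u d : L2} (h : (u, d) ∈ laplacianGraph) (φ : 𝓢(Plane, ℂ)) :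
    ∫ x, (Δ φ) x * u x = ∫ x, φ x * d x := by
  simpa using DFunLike.congr_fun (mem_laplacianGraph_iff.mp h) φ

theorem inner_toLp_laplacian_eq {u d : L2} (h : (u, d) ∈ laplacianGraph) (φ : 𝓢(Plane, ℂ)) :
    ⟪(Δ φ).toLp 2 volume, u⟫_ℂ = ⟪φ.toLp 2 volume, d⟫_ℂ := by
  let φ' : 𝓢(Plane, ℂ) := φ.postcompCLM (Complex.conjCLE : ℂ →L[ℝ] ℂ)
  have h_conj : ∀ x, (Δ φ') x = starRingEnd ℂ ((Δ φ) x) := fun x => by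
    rw [SchwartzMap.laplacian_apply, SchwartzMap.laplacian_apply]
    exact congrFun (InnerProductSpace.laplacian_CLE_comp_left (l := Complex.conjCLE)) x
  simp only [inner_toLp_eq_integral, ← h_conj]
  exact integral_laplacian_mul_eq h φ'

end PlaneOperators

section PlaneOscillator

variable {τ : ℝ}

theorem hermite_mem_laplacianGraph (hτ : 0 < τ) (p : MvPolynomial (Fin 2) ℂ) :
    (hermite hτ p, hermite hτ (lapPoly τ p)) ∈ laplacianGraph := by
  have h := toLp_mem_laplacianGraph (polyGauss hτ p)
  rwa [laplacian_polyGauss, ← lapPoly_apply] at h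

theorem inner_hermite_lapPoly_eq (hτ : 0 < τ) {u d : L2} (h : (u, d) ∈ laplacianGraph)
    (p : MvPolynomial (Fin 2) ℂ) : ⟪hermite hτ (lapPoly τ p), u⟫_ℂ = ⟪hermite hτ p, d⟫_ℂ := by
  rw [hermite_apply, lapPoly_apply, ← laplacian_polyGauss]
  exact inner_toLp_laplacian_eq h (polyGauss hτ p)

theorem oscResolvent_mem_laplacianGraph (hτ : 0 < τ) (y : L2) :
    (oscResolvent hτ y, lapResolvent hτ y) ∈ laplacianGraph := by
  refine osc_add_one_hermite_induction hτ y ?_ fun p => ?_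
  · exact isClosed_laplacianGraph.preimage (by fun_prop)
  · rw [oscResolvent_hermite, lapResolvent_hermite]
    exact hermite_mem_laplacianGraph hτ p

theorem oscResolvent_mem_mulOp_graph (hτ : 0 < τ) (y : L2) :
    (oscResolvent hτ y, normSqResolvent hτ y) ∈ (mulOp fun x => ‖x‖ ^ 2).graph :=
  mem_mulOp_graph_iff.mpr (normSq_mul_oscResolvent hτ y)

theorem eq_oscResolvent (hτ : 0 < τ) {u d m : L2} (hd : (u, d) ∈ laplacianGraph)
    (hm : (u, m) ∈ (mulOp fun x => ‖x‖ ^ 2).graph) :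
    u = oscResolvent hτ (-d + ((τ ^ 2 : ℝ) : ℂ) • m + u) := by
  simp only [mem_mulOp_graph_iff, ← polyEval_normSqPoly] at hm
  refine (isSelfAdjointCore_hermite hτ).eq_relOp_one_of_inner_eq fun p => ?_
  rw [LinearMap.add_apply, oscPoly_apply, Module.End.one_apply]
  simp only [map_add, map_neg, map_smul, inner_add_left, inner_add_right, inner_neg_left,
    inner_neg_right, inner_smul_left, inner_smul_right, Complex.conj_ofReal]
  rw [inner_hermite_lapPoly_eq hτ hd, inner_hermite_mul_eq_of_ae_eq hτ normSqPoly_mem_realPoly hm]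

end PlaneOscillator

section Potential

open MvPolynomial (pderiv)

/-- The polynomial `V + κ |x|²`. -/
def potPoly (κ : ℝ) : MvPolynomial (Fin 2) ℂ :=
  MvPolynomial.X 0 ^ 2 * MvPolynomial.X 1 -
      MvPolynomial.C ((1 / 3 : ℝ) : ℂ) * MvPolynomial.X 1 ^ 3 +
    MvPolynomial.C (κ : ℂ) * normSqPoly (Fin 2)

theorem potPoly_mem_realPoly (κ : ℝ) : potPoly κ ∈ realPoly (Fin 2) :=
  add_mem (sub_mem (mul_mem (pow_mem (X_mem_realPoly 0) 2) (X_mem_realPoly 1))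
    (mul_mem (C_ofReal_mem_realPoly _) (pow_mem (X_mem_realPoly 1) 3)))
    (mul_mem (C_ofReal_mem_realPoly κ) normSqPoly_mem_realPoly)

theorem polyEval_potPoly (κ : ℝ) (x : Plane) :
    polyEval (potPoly κ) x = ((potential x + κ * ‖x‖ ^ 2 : ℝ) : ℂ) := by
  simp only [potPoly, potential, map_add, map_sub, map_mul, map_pow, Pi.add_apply, Pi.sub_apply,
    Pi.mul_apply, Pi.pow_apply, polyEval_X, polyEval_C, polyEval_normSqPoly]
  push_cast
  ring

theorem polyEval_pderiv_zero_potPoly (κ : ℝ) (x : Plane) :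
    polyEval (pderiv 0 (potPoly κ)) x = ((2 * x 0 * x 1 + 2 * κ * x 0 : ℝ) : ℂ) := by
  simp only [potPoly, map_add, map_sub, map_mul, map_pow, map_ofNat polyEval, map_zero, map_one,
    Derivation.leibniz, Derivation.leibniz_pow, Nat.add_one_sub_one, pow_one, smul_eq_mul,
    nsmul_eq_mul, Nat.cast_ofNat, MvPolynomial.pderiv_C, MvPolynomial.pderiv_X_self,
    MvPolynomial.pderiv_X_of_ne one_ne_zero, pderiv_normSqPoly, polyEval_X, polyEval_C,
    Pi.add_apply, Pi.sub_apply, Pi.mul_apply, Pi.pow_apply, Pi.ofNat_apply]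
  push_cast
  ring

theorem polyEval_pderiv_one_potPoly (κ : ℝ) (x : Plane) :
    polyEval (pderiv 1 (potPoly κ)) x = ((x 0 ^ 2 - x 1 ^ 2 + 2 * κ * x 1 : ℝ) : ℂ) := by
  simp only [potPoly, map_add, map_sub, map_mul, map_pow, map_ofNat polyEval, map_zero, map_one,
    Derivation.leibniz, Derivation.leibniz_pow, Nat.add_one_sub_one, pow_one, smul_eq_mul,
    nsmul_eq_mul, Nat.cast_ofNat, MvPolynomial.pderiv_C, MvPolynomial.pderiv_X_self,
    MvPolynomial.pderiv_X_of_ne zero_ne_one, pderiv_normSqPoly, polyEval_X, polyEval_C,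
    Pi.add_apply, Pi.sub_apply, Pi.mul_apply, Pi.pow_apply, Pi.ofNat_apply]
  push_cast
  ring

theorem norm_polyEval_pderiv_potPoly_le (κ : ℝ) (j : Fin 2) (x : Plane) :
    ‖polyEval (pderiv j (potPoly κ)) x‖ ≤ (1 + |κ|) * ‖x‖ ^ 2 + |κ| := by
  have norm_sq_eq : ‖x‖ ^ 2 = x 0 ^ 2 + x 1 ^ 2 :=
    (EuclideanSpace.real_norm_sq_eq x).trans (Fin.sum_univ_two _)
  have abs_linear_le : ∀ t : ℝ, t ^ 2 ≤ ‖x‖ ^ 2 →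
      |2 * κ * t| ≤ |κ| * (‖x‖ ^ 2 + 1) := fun t ht => by
    rw [mul_right_comm, mul_comm, abs_mul]
    gcongr
    exact abs_le.mpr ⟨by nlinarith [sq_nonneg (t + 1)], by nlinarith [sq_nonneg (t - 1)]⟩
  have triangle : ∀ s t : ℝ, |s| ≤ ‖x‖ ^ 2 → t ^ 2 ≤ ‖x‖ ^ 2 →
      |s + 2 * κ * t| ≤ (1 + |κ|) * ‖x‖ ^ 2 + |κ| := fun s t hs ht => by
    linarith [abs_add_le s (2 * κ * t), abs_linear_le t ht]
  fin_cases j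
  · rw [Fin.zero_eta, polyEval_pderiv_zero_potPoly, Complex.norm_real, Real.norm_eq_abs]
    refine triangle _ _ (abs_le.mpr ⟨?_, ?_⟩) ?_ <;>
      nlinarith [sq_nonneg (x 0 - x 1), sq_nonneg (x 0 + x 1), sq_nonneg (x 1)]
  · rw [Fin.mk_one, polyEval_pderiv_one_potPoly, Complex.norm_real, Real.norm_eq_abs]
    refine triangle _ _ (abs_le.mpr ⟨?_, ?_⟩) ?_ <;>
      nlinarith [sq_nonneg (x 0), sq_nonneg (x 1)]

end Potential

section Parameters

theorem im_mul_exp {β : ℂ} {s : ℝ} (hs : β = ‖β‖ * Complex.exp (s * Complex.I)) (z : ℂ) :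
    (β * Complex.exp z).im = ‖β‖ * Real.exp z.re * Real.sin (z.im + s) := by
  have polar : β * Complex.exp z =
      (‖β‖ * Real.exp z.re : ℝ) * Complex.exp ((z.im + s : ℝ) * Complex.I) := by
    conv_lhs => rw [hs, ← Complex.re_add_im z]
    push_cast
    rw [mul_assoc, mul_assoc, ← Complex.exp_add, ← Complex.exp_add]
    congr 2
    ring
  rw [polar, Complex.im_ofReal_mul, Complex.exp_ofReal_mul_I_im]

theorem exists_eq_sq_add_mul {a b : ℂ} (hb : 0 < b.im)
    (hab : 0 < ((starRingEnd ℂ) a * b).im) :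
    ∃ τ κ : ℝ, 0 < τ ∧ a = ((τ ^ 2 : ℝ) : ℂ) + κ * b := by
  have h_pos : 0 < ((starRingEnd ℂ) a * b).im / b.im := div_pos hab hb
  refine ⟨√(((starRingEnd ℂ) a * b).im / b.im), a.im / b.im, Real.sqrt_pos.mpr h_pos, ?_⟩
  rw [Real.sq_sqrt h_pos.le, Complex.mul_im, Complex.conj_re, Complex.conj_im]
  apply Complex.ext
  · rw [Complex.add_re, Complex.ofReal_re, Complex.re_ofReal_mul]
    field_simp
    ring
  · rw [Complex.add_im, Complex.ofReal_im, Complex.im_ofReal_mul]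
    field_simp
    ring

theorem exists_parameters {β θ : ℂ} (h : (β, θ) ∈ parameterRegion) :
    0 < (β * Complex.exp (5 * θ)).im ∧ ∃ τ κ : ℝ, 0 < τ ∧
      Complex.exp (4 * θ) = ((τ ^ 2 : ℝ) : ℂ) + κ * (β * Complex.exp (5 * θ)) := by
  obtain ⟨hβ, s, hs, h_pos, h_lt, h_pos', h_lt'⟩ := h
  have im_pos : 0 < (β * Complex.exp (5 * θ)).im := by
    have im_eq : (5 * θ).im = 5 * θ.im := by simp
    rw [im_mul_exp hs, im_eq]
    exact mul_pos (by positivity) (Real.sin_pos_of_pos_of_lt_pi h_pos' h_lt')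
  refine ⟨im_pos, exists_eq_sq_add_mul im_pos ?_⟩
  have conj_mul_eq : (starRingEnd ℂ) (Complex.exp (4 * θ)) * (β * Complex.exp (5 * θ)) =
      β * Complex.exp ((starRingEnd ℂ) (4 * θ) + 5 * θ) := by
    rw [← Complex.exp_conj, Complex.exp_add]
    ring
  have im_eq : ((starRingEnd ℂ) (4 * θ) + 5 * θ).im = θ.im := by
    simp only [Complex.add_im, Complex.conj_im, Complex.mul_im, Complex.re_ofNat, Complex.im_ofNat]
    ring
  rw [conj_mul_eq, im_mul_exp hs, im_eq]
  exact mul_pos (by positivity) (Real.sin_pos_of_pos_of_lt_pi h_pos h_lt)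

end Parameters

section DilatedHamiltonian

variable {β θ : ℂ} {τ κ : ℝ}

theorem mem_dilatedH_graph_iff {u f : L2} :
    (u, f) ∈ (dilatedH β θ).graph ↔ ∃ d m v, (u, d) ∈ laplacianGraph ∧
      (u, m) ∈ (mulOp fun x => ‖x‖ ^ 2).graph ∧ (u, v) ∈ (mulOp potential).graph ∧
      (-Complex.exp (-2 * θ)) • d + Complex.exp (2 * θ) • m +
        (β * Complex.exp (3 * θ)) • v = f := by
  rw [dilatedH, mem_graph_add_iff]
  simp only [mem_graph_add_iff, mem_graph_smul_iff, laplaceOp_graph]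
  constructor
  · rintro ⟨_, _, ⟨_, _, ⟨d, hd, rfl⟩, ⟨m, hm, rfl⟩, rfl⟩, ⟨v, hv, rfl⟩, rfl⟩
    exact ⟨d, m, v, hd, hm, hv, rfl⟩
  · rintro ⟨d, m, v, hd, hm, hv, rfl⟩
    exact ⟨_, _, ⟨_, _, ⟨d, hd, rfl⟩, ⟨m, hm, rfl⟩, rfl⟩, ⟨v, hv, rfl⟩, rfl⟩

theorem mem_mulOp_add_mul_graph_iff {w₁ w₂ : Plane → ℝ} {u v m : L2}
    (hm : (u, m) ∈ (mulOp w₂).graph) :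
    (u, v + (κ : ℂ) • m) ∈ (mulOp fun x => w₁ x + κ * w₂ x).graph ↔
      (u, v) ∈ (mulOp w₁).graph := by
  rw [mem_mulOp_graph_iff] at hm ⊢
  rw [mem_mulOp_graph_iff]
  have coe_add_smul : (v + (κ : ℂ) • m : L2) =ᵐ[volume] fun x => v x + κ * m x := by
    filter_upwards [Lp.coeFn_add v ((κ : ℂ) • m), Lp.coeFn_smul (κ : ℂ) m] with x h_add h_smul
    rw [h_add, Pi.add_apply, h_smul, Pi.smul_apply, smul_eq_mul]
  refine Filter.eventually_congr ?_
  filter_upwards [hm, coe_add_smul] with x hm h_add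
  rw [h_add, ← hm, Complex.ofReal_add, Complex.ofReal_mul, add_mul, mul_assoc, add_left_inj]

theorem smul_sub_dilatedH_eq
    (h : Complex.exp (4 * θ) = ((τ ^ 2 : ℝ) : ℂ) + κ * (β * Complex.exp (5 * θ)))
    (l : ℂ) (u d m v : L2) :
    (-Complex.exp (-2 * θ) * (l + 1)) • u - ((-Complex.exp (-2 * θ)) • d +
        Complex.exp (2 * θ) • m + (β * Complex.exp (3 * θ)) • v) =
      (-Complex.exp (-2 * θ)) • ((-d + ((τ ^ 2 : ℝ) : ℂ) • m + u) + l • u +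
        (β * Complex.exp (5 * θ)) • (v + (κ : ℂ) • m)) := by
  have exp_two : Complex.exp (2 * θ) = Complex.exp (-2 * θ) * Complex.exp (4 * θ) := by
    rw [← Complex.exp_add]; congr 1; ring
  have exp_three : Complex.exp (3 * θ) = Complex.exp (-2 * θ) * Complex.exp (5 * θ) := by
    rw [← Complex.exp_add]; congr 1; ring
  rw [exp_two, exp_three, h]
  module

/-- With `b = β e^{5θ}`, this is the identity
`-e^{-2θ} (l + 1) - H(β, θ) = -e^{-2θ} (S + 1 + l + b W)`, where `S = -Δ + τ² |x|²` and
`W = V + κ |x|²`, the graph of `S + 1` being parametrized by its inverse. -/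
theorem mem_dilatedH_graph_iff_exists_oscResolvent (hτ : 0 < τ)
    (h : Complex.exp (4 * θ) = ((τ ^ 2 : ℝ) : ℂ) + κ * (β * Complex.exp (5 * θ)))
    (l : ℂ) {u f : L2} :
    (u, f) ∈ (dilatedH β θ).graph ↔ ∃ y g, oscResolvent hτ y = u ∧
      (u, g) ∈ (mulOp fun x => potential x + κ * ‖x‖ ^ 2).graph ∧
      (-Complex.exp (-2 * θ) * (l + 1)) • u - f =
        (-Complex.exp (-2 * θ)) • (y + l • u + (β * Complex.exp (5 * θ)) • g) := by
  rw [mem_dilatedH_graph_iff]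
  constructor
  · rintro ⟨d, m, v, hd, hm, hv, rfl⟩
    exact ⟨_, _, (eq_oscResolvent hτ hd hm).symm, (mem_mulOp_add_mul_graph_iff hm).mpr hv,
      smul_sub_dilatedH_eq h l u d m v⟩
  · rintro ⟨y, g, rfl, hg, h_eq⟩
    have hm := oscResolvent_mem_mulOp_graph hτ y
    refine ⟨lapResolvent hτ y, normSqResolvent hτ y, g - (κ : ℂ) • normSqResolvent hτ y,
      oscResolvent_mem_laplacianGraph hτ y, hm, ?_, ?_⟩
    · rwa [← mem_mulOp_add_mul_graph_iff hm, sub_add_cancel]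
    · refine sub_right_injective
        (b := (-Complex.exp (-2 * θ) * (l + 1)) • oscResolvent hτ y) ?_
      simp only [h_eq]
      rw [smul_sub_dilatedH_eq h, neg_lapResolvent_add_normSqResolvent_add_oscResolvent,
        sub_add_cancel]

theorem exists_isResolventAt_dilatedH (h : (β, θ) ∈ parameterRegion) :
    ∃ z R, IsResolventAt (dilatedH β θ) z R := by
  obtain ⟨hb, τ, κ, hτ, h_param⟩ := exists_parameters h
  obtain ⟨l, hl, h_solve⟩ := exists_solution_osc_add_mul hτ (potPoly_mem_realPoly κ)
    (by positivity) (abs_nonneg κ) (norm_polyEval_pderiv_potPoly_le κ) hb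
  simp only [polyEval_potPoly, ← mem_mulOp_graph_iff] at h_solve
  have exp_ne_zero : -Complex.exp (-2 * θ) ≠ 0 := neg_ne_zero.mpr (Complex.exp_ne_zero _)
  set b := β * Complex.exp (5 * θ)
  refine ⟨-Complex.exp (-2 * θ) * (l + 1), exists_isResolventAt
    (C := ‖b‖ / b.im * ‖-Complex.exp (-2 * θ)‖⁻¹) (fun f => ?_) fun u f huf => ?_⟩
  · obtain ⟨y, g, hg, hy⟩ := h_solve ((-Complex.exp (-2 * θ))⁻¹ • f)
    refine ⟨oscResolvent hτ y, _, (mem_dilatedH_graph_iff_exists_oscResolvent hτ h_param l).mpr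
      ⟨y, g, rfl, hg, ?_⟩, sub_sub_cancel _ f⟩
    rw [sub_sub_cancel, hy, smul_inv_smul₀ exp_ne_zero]
  · obtain ⟨y, g, rfl, hg, h_eq⟩ :=
      (mem_dilatedH_graph_iff_exists_oscResolvent hτ h_param l).mp huf
    rw [h_eq, norm_smul, mul_assoc, inv_mul_cancel_left₀ (norm_ne_zero_iff.mpr exp_ne_zero)]
    have core := isSelfAdjointCore_hermite (ι := Fin 2) hτ
    exact norm_le_of_im_inner_eq_zero hb hl (core.norm_sq_relOp_one_le y)
      (core.isSymmetric_relOp_one.im_inner_apply_self y)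
      (im_inner_eq_zero_of_mem_mulOp_graph hg)

theorem hasCompactResolvents_dilatedH (h : (β, θ) ∈ parameterRegion) :
    HasCompactResolvents (dilatedH β θ) := by
  refine ⟨exists_isResolventAt_dilatedH h, fun z R hR => ?_⟩
  obtain ⟨-, τ, κ, hτ, h_param⟩ := exists_parameters h
  refine isCompactOperator_of_range_subset (isCompactOperator_oscResolvent hτ)
    (isSelfAdjointCore_hermite hτ).relOp_one_injective ?_
  rintro _ ⟨f, rfl⟩
  obtain ⟨h_mem, -⟩ := hR.1 f
  obtain ⟨y, -, hy, -⟩ := (mem_dilatedH_graph_iff_exists_oscResolvent hτ h_param 0).mp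
    ((dilatedH β θ).mem_graph ⟨_, h_mem⟩)
  exact ⟨y, hy⟩

end DilatedHamiltonian

section HarmonicOscillator

open Filter Topology

/-- Multiplication by `|x|²` on Schwartz functions. -/
def normSqMul : 𝓢(Plane, ℂ) →L[ℂ] 𝓢(Plane, ℂ) :=
  SchwartzMap.smulLeftCLM ℂ fun x : Plane => ((‖x‖ ^ 2 : ℝ) : ℂ)

theorem normSqMul_apply (φ : 𝓢(Plane, ℂ)) (x : Plane) :
    normSqMul φ x = ((‖x‖ ^ 2 : ℝ) : ℂ) * φ x :=
  SchwartzMap.smulLeftCLM_apply_apply (by fun_prop) φ x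

theorem normSqMul_cutoff (c : 𝓢(Plane, ℂ)) (ε : ℝ) (φ : 𝓢(Plane, ℂ)) :
    normSqMul (cutoff c ε φ) = cutoff c ε (normSqMul φ) := by
  ext x
  rw [normSqMul_apply, cutoff_apply, cutoff_apply, normSqMul_apply, mul_left_comm]

theorem normSqMul_polyGauss {τ : ℝ} (hτ : 0 < τ) (p : MvPolynomial (Fin 2) ℂ) :
    normSqMul (polyGauss hτ p) = polyGauss hτ (normSqPoly (Fin 2) * p) := by
  ext x
  rw [normSqMul_apply, polyGauss_apply, polyGauss_apply, map_mul, Pi.mul_apply,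
    polyEval_normSqPoly, mul_assoc]

theorem toLp_mem_mulOp_graph (φ : 𝓢(Plane, ℂ)) :
    (φ.toLp 2 volume, (normSqMul φ).toLp 2 volume) ∈ (mulOp fun x => ‖x‖ ^ 2).graph := by
  rw [mem_mulOp_graph_iff]
  filter_upwards [φ.coeFn_toLp 2 volume, (normSqMul φ).coeFn_toLp 2 volume] with x hφ h_mul
  rw [hφ, h_mul, normSqMul_apply]

/-- The operator sum `-Δ + |x|²`, with the intersection of the two domains as its domain. -/
def oscSum : L2 →ₗ.[ℂ] L2 := -laplaceOp + mulOp (fun x => ‖x‖ ^ 2)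

theorem mem_oscSum_graph_iff {u f : L2} :
    (u, f) ∈ oscSum.graph ↔ ∃ d m, (u, d) ∈ laplacianGraph ∧
      (u, m) ∈ (mulOp fun x => ‖x‖ ^ 2).graph ∧ -d + m = f := by
  rw [oscSum, mem_graph_add_iff]
  constructor
  · rintro ⟨_, m, hd, hm, rfl⟩
    obtain ⟨y, rfl, rfl⟩ := (LinearPMap.mem_graph_iff _).mp hd
    exact ⟨laplaceOp y, m, laplaceOp_graph ▸ laplaceOp.mem_graph y, hm, rfl⟩
  · rintro ⟨d, m, hd, hm, rfl⟩
    rw [← laplaceOp_graph, LinearPMap.mem_graph_iff] at hd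
    obtain ⟨y, rfl, rfl⟩ := hd
    exact ⟨_, m, (-laplaceOp).mem_graph y, hm, rfl⟩

theorem mem_oscSum_graph_iff_eq_oscResolvent {u f : L2} :
    (u, f) ∈ oscSum.graph ↔ u = oscResolvent one_pos (f + u) := by
  rw [mem_oscSum_graph_iff]
  constructor
  · rintro ⟨d, m, hd, hm, rfl⟩
    have h := eq_oscResolvent one_pos hd hm
    rwa [one_pow, Complex.ofReal_one, one_smul] at h
  · intro h
    refine ⟨lapResolvent one_pos (f + u), normSqResolvent one_pos (f + u), ?_, ?_, ?_⟩
    · nth_rw 1 [h]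
      exact oscResolvent_mem_laplacianGraph _ _
    · nth_rw 1 [h]
      exact oscResolvent_mem_mulOp_graph _ _
    · have h_sum := neg_lapResolvent_add_normSqResolvent_add_oscResolvent one_pos (f + u)
      rwa [← h, one_pow, Complex.ofReal_one, one_smul, add_left_inj] at h_sum

theorem isClosed_oscSum : oscSum.IsClosed := by
  have graph_eq : (oscSum.graph : Set (L2 × L2)) =
      {p | p.1 = oscResolvent one_pos (p.2 + p.1)} :=
    Set.ext fun _ => mem_oscSum_graph_iff_eq_oscResolvent
  rw [LinearPMap.IsClosed, graph_eq]
  exact isClosed_eq (by fun_prop) (by fun_prop)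

theorem isClosable_oscSum_domRestrict : (oscSum.domRestrict testFunctions).IsClosable :=
  isClosed_oscSum.isClosable.leIsClosable LinearPMap.domRestrict_le

theorem harmonicOscillator_graph_eq_topologicalClosure : harmonicOscillator.graph =
    (oscSum.domRestrict testFunctions).graph.topologicalClosure :=
  isClosable_oscSum_domRestrict.graph_closure_eq_closure_graph.symm

theorem mem_domRestrict_graph {R E F : Type*} [Ring R] [AddCommGroup E] [Module R E]
    [AddCommGroup F] [Module R F] {A : E →ₗ.[R] F} {S : Submodule R E} {u : E} {f : F}
    (h : (u, f) ∈ A.graph) (hu : u ∈ S) : (u, f) ∈ (A.domRestrict S).graph := by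
  rw [LinearPMap.mem_graph_iff] at h ⊢
  obtain ⟨y, rfl, rfl⟩ := h
  exact ⟨⟨y, hu, y.2⟩, rfl, LinearPMap.domRestrict_apply rfl⟩

theorem toLp_cutoff_mem_testFunctions {c : 𝓢(Plane, ℂ)} (hc : HasCompactSupport c) {ε : ℝ}
    (hε : ε ≠ 0) (φ : 𝓢(Plane, ℂ)) : (cutoff c ε φ).toLp 2 volume ∈ testFunctions :=
  ⟨cutoff c ε φ, (cutoff c ε φ).smooth _, hasCompactSupport_cutoff hc hε φ,
    (cutoff c ε φ).coeFn_toLp 2 volume⟩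

theorem toLp_mem_harmonicOscillator_graph (φ : 𝓢(Plane, ℂ)) :
    (φ.toLp 2 volume, -(Δ φ).toLp 2 volume + (normSqMul φ).toLp 2 volume) ∈
      harmonicOscillator.graph := by
  obtain ⟨c, hc, hc0⟩ := exists_hasCompactSupport_eq_one Plane
  have tendsto_image :=
    (tendsto_toLp_laplacian_cutoff (μ := volume) c φ).neg.add (tendsto_toLp_cutoff c (normSqMul φ))
  have tendsto_pair := ((tendsto_toLp_cutoff (μ := volume) c φ).prodMk_nhds tendsto_image).mono_left
    (nhdsWithin_le_nhds (s := {0}ᶜ))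
  simp only [hc0, one_smul] at tendsto_pair
  rw [harmonicOscillator_graph_eq_topologicalClosure]
  refine mem_closure_of_tendsto tendsto_pair ?_
  filter_upwards [self_mem_nhdsWithin] with ε hε
  refine mem_domRestrict_graph ?_ (toLp_cutoff_mem_testFunctions hc hε φ)
  rw [← normSqMul_cutoff]
  exact mem_oscSum_graph_iff.mpr
    ⟨_, _, toLp_mem_laplacianGraph _, toLp_mem_mulOp_graph _, rfl⟩

theorem oscResolvent_mem_harmonicOscillator_graph (y : L2) :
    (oscResolvent one_pos y, y - oscResolvent one_pos y) ∈ harmonicOscillator.graph := by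
  refine osc_add_one_hermite_induction one_pos y ?_ fun p => ?_
  · rw [harmonicOscillator_graph_eq_topologicalClosure]
    exact (Submodule.isClosed_topologicalClosure _).preimage (by fun_prop)
  · have h := toLp_mem_harmonicOscillator_graph (polyGauss one_pos p)
    rw [normSqMul_polyGauss, laplacian_polyGauss, ← lapPoly_apply] at h
    simp only [← hermite_apply] at h
    rwa [oscResolvent_hermite, LinearMap.add_apply, Module.End.one_apply, map_add,
      add_sub_cancel_right, oscPoly_apply, one_pow, Complex.ofReal_one, one_smul, map_add, map_neg]

theorem harmonicOscillator_eq_oscSum : harmonicOscillator = oscSum := by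
  refine LinearPMap.eq_of_eq_graph (le_antisymm ?_ ?_)
  · rw [harmonicOscillator_graph_eq_topologicalClosure]
    exact Submodule.topologicalClosure_minimal _
      (LinearPMap.le_graph_of_le LinearPMap.domRestrict_le) isClosed_oscSum
  · rintro ⟨u, f⟩ h
    rw [mem_oscSum_graph_iff_eq_oscResolvent] at h
    have h_mem := oscResolvent_mem_harmonicOscillator_graph (f + u)
    rwa [← h, add_sub_cancel_right] at h_mem

theorem harmonicOscillator_domain :
    harmonicOscillator.domain = laplaceOp.domain ⊓ (mulOp fun x => ‖x‖ ^ 2).domain := by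
  rw [harmonicOscillator_eq_oscSum]
  rfl

end HarmonicOscillator

section ParameterRegion

theorem parameterRegion_eq_image : parameterRegion =
    Prod.map Complex.exp id '' {p : ℂ × ℂ | (p.1.im, p.2.im) ∈ parallelogram} := by
  ext ⟨β, θ⟩
  constructor
  · rintro ⟨hβ, s, hs, h⟩
    refine ⟨(Real.log ‖β‖ + s * Complex.I, θ), by simpa using h, Prod.ext ?_ rfl⟩
    change Complex.exp _ = β
    rw [Complex.exp_add, ← Complex.ofReal_exp, Real.exp_log (norm_pos_iff.mpr hβ)]
    exact hs.symm
  · rintro ⟨⟨w, θ'⟩, h, h_eq⟩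
    obtain ⟨rfl, rfl⟩ := Prod.mk.inj h_eq
    refine ⟨Complex.exp_ne_zero w, w.im, ?_, h⟩
    change Complex.exp w = _
    rw [Complex.norm_exp, Complex.ofReal_exp, ← Complex.exp_add, Complex.re_add_im]

theorem isOpen_parallelogram : IsOpen parallelogram := by
  simp only [parallelogram, Set.ofPred_and]
  refine IsOpen.inter ?_ (IsOpen.inter ?_ (IsOpen.inter ?_ ?_)) <;>
    exact isOpen_lt (by fun_prop) (by fun_prop)

theorem convex_parallelogram : Convex ℝ parallelogram := by
  let sum : ℝ × ℝ →ₗ[ℝ] ℝ := LinearMap.snd ℝ ℝ ℝ + LinearMap.fst ℝ ℝ ℝ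
  let sum' : ℝ × ℝ →ₗ[ℝ] ℝ := (5 : ℝ) • LinearMap.snd ℝ ℝ ℝ + LinearMap.fst ℝ ℝ ℝ
  exact (convex_halfSpace_gt sum.isLinear 0).inter ((convex_halfSpace_lt sum.isLinear _).inter
    ((convex_halfSpace_gt sum'.isLinear 0).inter (convex_halfSpace_lt sum'.isLinear _)))

theorem isOpen_parameterRegion : IsOpen parameterRegion := by
  rw [parameterRegion_eq_image]
  refine (Complex.isOpenMap_exp.prodMap IsOpenMap.id) _ (isOpen_parallelogram.preimage ?_)
  fun_prop

theorem isConnected_parameterRegion : IsConnected parameterRegion := by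
  rw [parameterRegion_eq_image]
  refine IsConnected.image (Convex.isConnected ?_ ?_) _
    (Complex.continuous_exp.prodMap continuous_id).continuousOn
  · exact convex_parallelogram.linear_preimage
      ((Complex.imLm.comp (LinearMap.fst ℝ ℂ ℂ)).prod (Complex.imLm.comp (LinearMap.snd ℝ ℂ ℂ)))
  · refine ⟨((Real.pi / 2 : ℝ) * Complex.I, 0), ?_⟩
    simp only [parallelogram, Set.mem_ofPred_eq, Complex.im_ofReal_mul, Complex.I_im,
      Complex.zero_im]
    refine ⟨?_, ?_, ?_, ?_⟩ <;> linarith [Real.pi_pos]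

end ParameterRegion

section HolomorphicFamily

theorem dilatedH_domain (β θ : ℂ) :
    (dilatedH β θ).domain = harmonicOscillator.domain ⊓ (mulOp potential).domain := by
  rw [harmonicOscillator_domain]
  rfl

theorem exists_differentiable_mem_dilatedH_graph {u : L2}
    (hu : u ∈ harmonicOscillator.domain ⊓ (mulOp potential).domain) :
    ∃ f : ℂ × ℂ → L2, Differentiable ℂ f ∧ ∀ p, (u, f p) ∈ (dilatedH p.1 p.2).graph := by
  rw [harmonicOscillator_domain] at hu
  obtain ⟨⟨hd, hm⟩, hv⟩ := hu
  refine ⟨fun p => (-Complex.exp (-2 * p.2)) • laplaceOp ⟨u, hd⟩ +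
    Complex.exp (2 * p.2) • mulOp _ ⟨u, hm⟩ +
    (p.1 * Complex.exp (3 * p.2)) • mulOp potential ⟨u, hv⟩, by fun_prop, fun p => ?_⟩
  exact mem_dilatedH_graph_iff.mpr ⟨_, _, _, laplaceOp_graph ▸ laplaceOp.mem_graph ⟨u, hd⟩,
    LinearPMap.mem_graph _ ⟨u, hm⟩, LinearPMap.mem_graph _ ⟨u, hv⟩, rfl⟩

theorem isClosed_dilatedH {β θ : ℂ} (h : (β, θ) ∈ parameterRegion) : (dilatedH β θ).IsClosed := by
  obtain ⟨_, _, hR⟩ := exists_isResolventAt_dilatedH h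
  exact hR.isClosed

theorem isHolomorphicFamilyTypeA_dilatedH :
    IsHolomorphicFamilyTypeA parameterRegion (fun p : ℂ × ℂ => dilatedH p.1 p.2)
      (harmonicOscillator.domain ⊓ (mulOp potential).domain) where
  isOpen := isOpen_parameterRegion
  isConnected := isConnected_parameterRegion
  isClosed _ hp := isClosed_dilatedH hp
  domain_eq p _ := dilatedH_domain p.1 p.2
  holomorphic _ hu := by
    obtain ⟨f, hf, h_graph⟩ := exists_differentiable_mem_dilatedH_graph hu
    exact ⟨f, hf.differentiableOn, fun p _ => h_graph p⟩

end HolomorphicFamily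

end HenonHeiles

end

theorem theorem2p6 :
    HenonHeiles.IsHolomorphicFamilyTypeA HenonHeiles.parameterRegion
        (fun p : ℂ × ℂ => HenonHeiles.dilatedH p.1 p.2)
        (HenonHeiles.harmonicOscillator.domain ⊓
          (HenonHeiles.mulOp HenonHeiles.potential).domain) ∧
      ∀ p ∈ HenonHeiles.parameterRegion,
        HenonHeiles.HasCompactResolvents (HenonHeiles.dilatedH p.1 p.2) :=
  ⟨HenonHeiles.isHolomorphicFamilyTypeA_dilatedH,
    fun _ hp => HenonHeiles.hasCompactResolvents_dilatedH hp⟩
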